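/- \textbf{Theorem (weak entropy inequality for scalar conservation laws with Riesz--Feller diffusion).} Let $1<\beta<2$, $|\gamma|\le\min\{\beta,2-\beta\}$ and $f\in C^\infty(\mathbb{R})$. Let $D^\beta_\gamma$ be the Riesz--Feller operator of order $\beta$ and skewness $\gamma$, that is, the Fourier multiplier operator on Schwartz functions given by $\mathcal{F}(D^\beta_\gamma[v])(\xi)=-|\xi|^\beta e^{i\,\mathrm{sign}(\xi)\gamma\pi/2}\,\mathcal{F}(v)(\xi)$, with $\mathcal{F}(v)(\xi)=(2\pi)^{-1/2}\int_{\mathbb{R}}v(x)e^{-i\xi x}\,dx$, extended to $v\in C^2_b(\mathbb{R})$ by its singular integral representation $$D^\beta_\gamma[v](x)=c^1_\gamma\int_0^\infty\frac{v(x+z)-v(x)-v'(x)z}{z^{1+\beta}}\,dz+c^2_\gamma\int_0^\infty\frac{v(x-z)-v(x)+v'(x)z}{z^{1+\beta}}\,dz,$$ $$c^1_\gamma=\frac{\Gamma(1+\beta)}{\pi}\sin\frac{(\beta-\gamma)\pi}{2},\qquad c^2_\gamma=\frac{\Gamma(1+\beta)}{\pi}\sin\frac{(\beta+\gamma)\pi}{2}.$$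 Put $d_\alpha=1/\Gamma(1-\alpha)$ and, for $0<\alpha<1$, $$\mathcal{D}^\alpha[g](x)=d_\alpha\int_{-\infty}^x\frac{g'(z)}{(x-z)^\alpha}\,dz,\qquad \overline{\mathcal{D}^\alpha}[g](x)=d_\alpha\int_x^{\infty}\frac{g'(z)}{(z-x)^\alpha}\,dz,$$ and let $$\overline{D^\beta_\gamma}[g](x)=\frac{1}{d_{\beta+1}}\Big(c^1_\gamma\,\partial_x\mathcal{D}^{\beta-1}[g](x)+c^2_\gamma\,\partial_x\overline{\mathcal{D}^{\beta-1}}[g](x)\Big)$$ be the adjoint of $D^\beta_\gamma$. Let $u\in C^2_b((0,\infty)\times\mathbb{R})$ (that is, $u$ is $C^2$ there and $u$ and its partial derivatives of order at most $2$ are bounded) satisfy $$\partial_t u(t,x)+\partial_x f(u(t,x))=D^\beta_\gamma[u(t,\cdot)](x)\qquad\text{for all } t>0,\ x\in\mathbb{R}.$$ Let $\eta\in C(\mathbb{R})$ be convex and put $$q(w)=f'(w)\eta(w)-f'(0)\eta(0)-\int_0^w f''(z)\eta(z)\,dz .$$ Then for all non-negative $\varphi\in C_c^\infty((0,\infty)\times\mathbb{R})$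 the integrand below is integrable on $(0,\infty)\times\mathbb{R}$, and $$\int_0^\infty\int_{\mathbb{R}}\Big(\eta(u(t,x))\,\partial_t\varphi(t,x)+q(u(t,x))\,\partial_x\varphi(t,x)+\eta(u(t,x))\,\overline{D^\beta_\gamma}[\varphi(t,\cdot)](x)\Big)\,dx\,dt\ \ge\ 0 .$$ -/

import Mathlib

open MeasureTheory Set Filter Topology
open scoped SchwartzMap FourierTransform ContDiff

namespace RieszFeller

/-! ### The Riesz–Feller operator -/

/-- The Fourier transform `(2π)^(-1/2) ∫ v(x) e^{-iξx} dx`. -/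
noncomputable def fourierT (v : ℝ → ℂ) (ξ : ℝ) : ℂ :=
  ((1 / √(2 * Real.pi) : ℝ) : ℂ) * ∫ x : ℝ, v x * Complex.exp (-(Complex.I * ξ * x))

/-- The inverse Fourier transform `(2π)^(-1/2) ∫ w(ξ) e^{iξx} dξ`. -/
noncomputable def fourierTInv (w : ℝ → ℂ) (x : ℝ) : ℂ :=
  ((1 / √(2 * Real.pi) : ℝ) : ℂ) * ∫ ξ : ℝ, w ξ * Complex.exp (Complex.I * ξ * x)

/-- The Riesz–Feller symbol `ψ(ξ) = -|ξ|^β exp(i sign(ξ) γ π/2)`. -/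
noncomputable def symbol (β γ ξ : ℝ) : ℂ :=
  -((|ξ| ^ β : ℝ) : ℂ) * Complex.exp (Complex.I * (Real.sign ξ * γ * (Real.pi / 2)))

/-- The weight of the right half-line in the singular integral. -/
noncomputable def cOne (β γ : ℝ) : ℝ :=
  Real.Gamma (1 + β) * Real.sin ((β - γ) * Real.pi / 2) / Real.pi

/-- The weight of the left half-line in the singular integral. -/
noncomputable def cTwo (β γ : ℝ) : ℝ :=
  Real.Gamma (1 + β) * Real.sin ((β + γ) * Real.pi / 2) / Real.pi

/-- The Riesz–Feller operator of order `β` and skewness `γ`, for `1 < β < 2`, in its singular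
integral form, which makes sense for all functions that are bounded and `C²` with bounded
derivatives. On Schwartz functions it is the Fourier multiplier operator with symbol
`symbol β γ`: see `rieszFeller_eq_fourier` below. -/
noncomputable def rieszFeller (β γ : ℝ) (v : ℝ → ℝ) (x : ℝ) : ℝ :=
  cOne β γ * (∫ z in Ioi (0 : ℝ), (v (x + z) - v x - deriv v x * z) / z ^ (1 + β)) +
  cTwo β γ * (∫ z in Ioi (0 : ℝ), (v (x - z) - v x + deriv v x * z) / z ^ (1 + β))

/-! ### The adjoint operator -/

/-- `d_α = 1 / Γ(1 - α)`. -/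
noncomputable def dCoef (α : ℝ) : ℝ := 1 / Real.Gamma (1 - α)

/-- `𝒟^α[g](x) = d_α ∫_{-∞}^x g'(z) / (x - z)^α dz`. -/
noncomputable def caputoLeft (α : ℝ) (g : ℝ → ℝ) (x : ℝ) : ℝ :=
  dCoef α * ∫ z in Iio x, deriv g z / (x - z) ^ α

/-- `d_α ∫_x^∞ g'(z) / (z - x)^α dz`. -/
noncomputable def caputoRight (α : ℝ) (g : ℝ → ℝ) (x : ℝ) : ℝ :=
  dCoef α * ∫ z in Ioi x, deriv g z / (z - x) ^ α

/-- The adjoint of `rieszFeller β γ`. The weight `cOne` of the right half-line in `rieszFeller`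
goes to the left-sided derivative here, and `cTwo` to the right-sided one. -/
noncomputable def rieszFellerAdj (β γ : ℝ) (g : ℝ → ℝ) (x : ℝ) : ℝ :=
  1 / dCoef (β + 1) *
    (cOne β γ * deriv (fun y => caputoLeft (β - 1) g y) x +
      cTwo β γ * deriv (fun y => caputoRight (β - 1) g y) x)

/-! ### Solutions and entropy fluxes -/

/-- `u ∈ C²_b((0,∞) × ℝ)`: twice continuously differentiable there, with `u` and all its partial
derivatives of order at most two bounded. -/
structure IsCbTwo (u : ℝ → ℝ → ℝ) : Prop where
  contDiffOn : ContDiffOn ℝ 2 (Function.uncurry u) (Ioi (0 : ℝ) ×ˢ univ)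
  bounded : ∀ k : ℕ, k ≤ 2 → ∃ C : ℝ, ∀ p ∈ Ioi (0 : ℝ) ×ˢ (univ : Set ℝ),
    ‖iteratedFDeriv ℝ k (Function.uncurry u) p‖ ≤ C

/-- `u` solves `∂ₜu + ∂ₓ f(u) = D[u]` at every point of `(0,∞) × ℝ`. -/
def IsSolution (β γ : ℝ) (f : ℝ → ℝ) (u : ℝ → ℝ → ℝ) : Prop :=
  ∀ t : ℝ, 0 < t → ∀ x : ℝ,
    deriv (fun s => u s x) t + deriv (fun y => f (u t y)) x = rieszFeller β γ (u t) x

/-- The flux `q(w) = f'(w) η(w) - f'(0) η(0) - ∫_0^w f''(z) η(z) dz` of the entropy `η`. -/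
noncomputable def entropyFlux (f η : ℝ → ℝ) (w : ℝ) : ℝ :=
  deriv f w * η w - deriv f 0 * η 0 - ∫ z in (0 : ℝ)..w, deriv (deriv f) z * η z

/-- The integrand `η(u) ∂ₜφ + q(u) ∂ₓφ + η(u) D̄[φ(t,·)]` of the entropy inequality. -/
noncomputable def entropyIntegrand (β γ : ℝ) (f η : ℝ → ℝ) (u φ : ℝ → ℝ → ℝ) (t x : ℝ) : ℝ :=
  η (u t x) * deriv (fun s => φ s x) t + entropyFlux f η (u t x) * deriv (φ t) x +
    η (u t x) * rieszFellerAdj β γ (φ t) x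

/-! ### The singular integral agrees with the Fourier multiplier -/

noncomputable def expRem (w : ℂ) : ℂ := Complex.exp (-w) - 1 + w

theorem hasDerivAt_K (w : ℂ) : HasDerivAt expRem (1 - Complex.exp (-w)) w := by
  unfold expRem
  have h := (((hasDerivAt_neg w).cexp).sub_const 1).add (hasDerivAt_id w)
  refine h.congr_deriv ?_
  ring

theorem continuous_K : Continuous expRem := by unfold expRem; fun_prop

theorem norm_one_sub_exp_le {w : ℂ} (hw : 0 ≤ w.re) : ‖1 - Complex.exp (-w)‖ ≤ ‖w‖ := by
  have hc : Convex ℝ {w : ℂ | 0 ≤ w.re} := convex_halfSpace_re_ge 0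
  have h := hc.norm_image_sub_le_of_norm_hasDerivWithin_le (f := fun w => Complex.exp (-w))
    (f' := fun w => - Complex.exp (-w)) (C := 1) (x := w) (y := 0)
    (fun x _ => by
      have := ((hasDerivAt_neg x).cexp).hasDerivWithinAt (s := {w : ℂ | 0 ≤ w.re})
      convert this using 1; ring)
    (fun x hx => by
      rw [norm_neg, Complex.norm_exp]
      simpa using hx) hw (by simp)
  simpa using h

theorem norm_K_le_sq {w : ℂ} (hw : 0 ≤ w.re) : ‖expRem w‖ ≤ ‖w‖ ^ 2 := by
  have hc : Convex ℝ ({w : ℂ | 0 ≤ w.re} ∩ Metric.closedBall 0 ‖w‖) :=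
    (convex_halfSpace_re_ge 0).inter (convex_closedBall _ _)
  have h := hc.norm_image_sub_le_of_norm_hasDerivWithin_le (f := expRem)
    (f' := fun w => 1 - Complex.exp (-w)) (C := ‖w‖) (x := 0) (y := w)
    (fun x _ => (hasDerivAt_K x).hasDerivWithinAt)
    (fun x hx => (norm_one_sub_exp_le hx.1).trans (by simpa using hx.2))
    (by simp) (by simpa using hw)
  have h0 : expRem 0 = 0 := by simp [expRem]
  rw [h0, sub_zero, sub_zero] at h
  nlinarith

theorem norm_K_le {w : ℂ} (hw : 0 ≤ w.re) : ‖expRem w‖ ≤ 2 * ‖w‖ := by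
  have : expRem w = -(1 - Complex.exp (-w)) + w := by unfold expRem; ring
  rw [this]
  refine (norm_add_le _ _).trans ?_
  rw [norm_neg]
  linarith [norm_one_sub_exp_le hw]

theorem norm_one_sub_exp_le_two {w : ℂ} (hw : 0 ≤ w.re) : ‖1 - Complex.exp (-w)‖ ≤ 2 := by
  refine (norm_sub_le _ _).trans ?_
  have : ‖Complex.exp (-w)‖ ≤ 1 := by rw [Complex.norm_exp]; simpa using hw
  simp only [norm_one]; linarith

noncomputable def domFun (a b : ℝ) (z : ℝ) : ℝ := min (z ^ a) (z ^ b)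

theorem integrableOn_dom {a b : ℝ} (ha : -1 < a) (hb : b < -1) :
    IntegrableOn (domFun a b) (Ioi 0) := by
  rw [← Ioc_union_Ioi_eq_Ioi (zero_le_one' ℝ)]
  have hm : Measurable (domFun a b) := by unfold domFun; fun_prop
  have hn : ∀ z : ℝ, 0 < z → 0 ≤ domFun a b z := fun z hz =>
    le_min (Real.rpow_nonneg hz.le _) (Real.rpow_nonneg hz.le _)
  refine IntegrableOn.union ?_ ?_
  · have h := (intervalIntegral.intervalIntegrable_rpow' (a := 0) (b := 1) ha).1
    refine h.mono' hm.aestronglyMeasurable ?_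
    refine (ae_restrict_iff' measurableSet_Ioc).2 (ae_of_all _ fun z hz => ?_)
    rw [Real.norm_of_nonneg (hn z hz.1)]; exact min_le_left _ _
  · have h := integrableOn_Ioi_rpow_of_lt hb one_pos
    refine h.mono' hm.aestronglyMeasurable ?_
    refine (ae_restrict_iff' measurableSet_Ioi).2 (ae_of_all _ fun z hz => ?_)
    rw [Real.norm_of_nonneg (hn z (one_pos.trans hz))]; exact min_le_right _ _

theorem norm_K_mul_le {β : ℝ} {s : ℂ} {z : ℝ} (hs : 0 ≤ s.re) (hz : 0 < z) :
    ‖expRem (s * z) * ((z ^ (-1 - β) : ℝ) : ℂ)‖ ≤ (‖s‖ ^ 2 + 2 * ‖s‖) * domFun (1 - β) (-β) z := by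
  have hre : 0 ≤ (s * z).re := by simp; positivity
  have h1 := norm_K_le_sq hre
  have h2 := norm_K_le hre
  have hnz : ‖s * z‖ = ‖s‖ * z := by simp [abs_of_pos hz]
  rw [hnz] at h1 h2
  rw [norm_mul, Complex.norm_real, Real.norm_of_nonneg (Real.rpow_nonneg hz.le _)]
  have e1 : z ^ (1 - β) = z ^ 2 * z ^ (-1 - β) := by
    rw [← Real.rpow_natCast, ← Real.rpow_add hz]; congr 1; push_cast; ring
  have e2 : z ^ (-β) = z * z ^ (-1 - β) := by
    nth_rewrite 2 [← Real.rpow_one z]; rw [← Real.rpow_add hz]; congr 1; ring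
  have hp : 0 ≤ z ^ (-1 - β) := Real.rpow_nonneg hz.le _
  unfold domFun
  rw [e1, e2, ← min_mul_of_nonneg _ _ hp, ← mul_assoc]
  refine mul_le_mul_of_nonneg_right ?_ hp
  have hn := norm_nonneg s
  rcases min_choice (z ^ 2) z with h | h <;> rw [h]
  · nlinarith [sq_nonneg z]
  · nlinarith [sq_nonneg ‖s‖]

noncomputable def expRemInt (β : ℝ) (s : ℂ) : ℂ := ∫ z in Ioi (0:ℝ), expRem (s * z) * ((z ^ (-1 - β) : ℝ) : ℂ)

theorem aesm_A (β : ℝ) (s : ℂ) :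
    AEStronglyMeasurable (fun z : ℝ => expRem (s * z) * ((z ^ (-1 - β) : ℝ) : ℂ))
      (volume.restrict (Ioi 0)) := by
  have := continuous_K.measurable
  exact (Measurable.mul (this.comp (by fun_prop)) (by fun_prop)).aestronglyMeasurable

theorem integrable_A {β : ℝ} (h1 : 1 < β) (h2 : β < 2) {s : ℂ} (hs : 0 ≤ s.re) :
    IntegrableOn (fun z : ℝ => expRem (s * z) * ((z ^ (-1 - β) : ℝ) : ℂ)) (Ioi 0) := by
  refine ((integrableOn_dom (a := 1 - β) (b := -β) (by linarith) (by linarith)).const_mul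
    (‖s‖ ^ 2 + 2 * ‖s‖)).mono' (aesm_A _ _) ?_
  exact (ae_restrict_iff' measurableSet_Ioi).2 (ae_of_all _ fun z hz => norm_K_mul_le hs hz)

theorem continuousOn_A {β : ℝ} (h1 : 1 < β) (h2 : β < 2) : ContinuousOn (expRemInt β) {s | 0 ≤ s.re} := by
  intro s0 hs0
  unfold expRemInt
  refine continuousWithinAt_of_dominated
    (bound := fun z => ((‖s0‖ + 1) ^ 2 + 2 * (‖s0‖ + 1)) * domFun (1 - β) (-β) z)
    (Eventually.of_forall fun s => aesm_A _ _) ?_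
    ((integrableOn_dom (a := 1 - β) (b := -β) (by linarith) (by linarith)).const_mul _) ?_
  · have hb : ∀ᶠ s in 𝓝[{s | 0 ≤ s.re}] s0, ‖s‖ ≤ ‖s0‖ + 1 :=
      ((continuous_norm.tendsto s0).mono_left nhdsWithin_le_nhds).eventually_le_const (by linarith)
    filter_upwards [self_mem_nhdsWithin, hb] with s hs hsb
    refine (ae_restrict_iff' measurableSet_Ioi).2 (ae_of_all _ fun z hz => ?_)
    refine (norm_K_mul_le hs hz).trans ?_
    have : 0 ≤ domFun (1 - β) (-β) z :=
      le_min (Real.rpow_nonneg (le_of_lt hz) _) (Real.rpow_nonneg (le_of_lt hz) _)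
    gcongr
  · refine ae_of_all _ fun z => ?_
    have := continuous_K
    exact (Continuous.continuousWithinAt (by fun_prop))

theorem differentiableOn_A {β : ℝ} (h1 : 1 < β) (h2 : β < 2) :
    DifferentiableOn ℂ (expRemInt β) {s | 0 < s.re} := by
  intro s0 hs0
  have hU : {s : ℂ | 0 < s.re} ∩ Metric.ball s0 1 ∈ 𝓝 s0 :=
    inter_mem ((isOpen_lt continuous_const Complex.continuous_re).mem_nhds hs0)
      (Metric.ball_mem_nhds _ one_pos)
  have := hasDerivAt_integral_of_dominated_loc_of_deriv_le (μ := volume.restrict (Ioi (0:ℝ)))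
    (F := fun (s : ℂ) (z : ℝ) => expRem (s * z) * ((z ^ (-1 - β) : ℝ) : ℂ))
    (F' := fun (s : ℂ) (z : ℝ) => (1 - Complex.exp (-(s * z))) * z * ((z ^ (-1 - β) : ℝ) : ℂ))
    (bound := fun z => (‖s0‖ + 3) * domFun (1 - β) (-β) z)
    (x₀ := s0) hU (Eventually.of_forall fun s => aesm_A _ _)
    (integrable_A h1 h2 (le_of_lt hs0)) (by
      refine Measurable.aestronglyMeasurable ?_
      fun_prop) (by
      refine (ae_restrict_iff' measurableSet_Ioi).2 (ae_of_all _ fun z (hz : 0 < z) s hs => ?_)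
      have hre : 0 ≤ (s * z).re := by
        have : 0 < s.re := hs.1
        simp; positivity
      have b1 := norm_one_sub_exp_le hre
      have b2 := norm_one_sub_exp_le_two hre
      have hnz : ‖s * z‖ = ‖s‖ * z := by simp [abs_of_pos hz]
      rw [hnz] at b1
      have hsn : ‖s‖ ≤ ‖s0‖ + 1 := by
        have := mem_ball_iff_norm.1 hs.2
        have := norm_le_norm_add_norm_sub' s s0
        linarith
      rw [norm_mul, norm_mul, Complex.norm_real, Complex.norm_real,
        Real.norm_of_nonneg (Real.rpow_nonneg hz.le _), Real.norm_of_nonneg hz.le]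
      have e1 : z ^ (1 - β) = z ^ 2 * z ^ (-1 - β) := by
        rw [← Real.rpow_natCast, ← Real.rpow_add hz]; congr 1; push_cast; ring
      have e2 : z ^ (-β) = z * z ^ (-1 - β) := by
        nth_rewrite 2 [← Real.rpow_one z]; rw [← Real.rpow_add hz]; congr 1; ring
      have hp : 0 ≤ z ^ (-1 - β) := Real.rpow_nonneg hz.le _
      unfold domFun
      rw [e1, e2, ← min_mul_of_nonneg _ _ hp, ← mul_assoc]
      refine mul_le_mul_of_nonneg_right ?_ hp
      have hn := norm_nonneg s0
      have hn' := norm_nonneg s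
      rcases min_choice (z ^ 2) z with h | h <;> rw [h]
      · have : ‖s‖ * z * z ≤ (‖s0‖ + 3) * z * z := by gcongr; linarith
        nlinarith
      · nlinarith)
    ((integrableOn_dom (a := 1 - β) (b := -β) (by linarith) (by linarith)).const_mul _) (by
      refine ae_of_all _ fun z s _ => ?_
      have h := ((hasDerivAt_K (s * z)).comp s ((hasDerivAt_id s).mul_const (z : ℂ))).mul_const
        ((z ^ (-1 - β) : ℝ) : ℂ)
      rw [one_mul] at h
      exact h)
  exact this.2.differentiableAt.differentiableWithinAt

theorem A_ofReal {β r : ℝ} (hr : 0 < r) : expRemInt β r = expRemInt β 1 * (r : ℂ) ^ (β : ℂ) := by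
  have h := integral_comp_mul_left_Ioi
    (fun z : ℝ => expRem z * ((z ^ (-1 - β) : ℝ) : ℂ)) 0 hr
  have e : expRemInt β 1 = ∫ z in Ioi (0:ℝ), expRem z * ((z ^ (-1 - β) : ℝ) : ℂ) := by simp [expRemInt]
  rw [mul_zero, ← e] at h
  have e2 : expRemInt β r * ((r ^ (-1 - β) : ℝ) : ℂ)
      = ∫ z in Ioi (0:ℝ), expRem ((r * z : ℝ)) * (((r * z) ^ (-1 - β) : ℝ) : ℂ) := by
    unfold expRemInt
    rw [← integral_mul_const]
    refine setIntegral_congr_fun measurableSet_Ioi fun z (hz : 0 < z) => ?_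
    rw [Real.mul_rpow hr.le hz.le]
    push_cast; ring
  rw [← e2] at h
  have hp : ((r ^ (-1 - β) : ℝ) : ℂ) ≠ 0 := by
    exact_mod_cast (Real.rpow_pos_of_pos hr _).ne'
  rw [← Complex.ofReal_cpow hr.le]
  apply mul_right_cancel₀ hp
  rw [h, mul_assoc, ← Complex.ofReal_mul, ← Real.rpow_add hr]
  have : β + (-1 - β) = -1 := by ring
  rw [this, Real.rpow_neg_one, Complex.real_smul, mul_comm]

theorem A_eq {β : ℝ} (h1 : 1 < β) (h2 : β < 2) {s : ℂ} (hs : 0 < s.re) :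
    expRemInt β s = expRemInt β 1 * s ^ (β : ℂ) := by
  have hopen : IsOpen {s : ℂ | 0 < s.re} := isOpen_lt continuous_const Complex.continuous_re
  have hf : AnalyticOnNhd ℂ (expRemInt β) {s | 0 < s.re} := (differentiableOn_A h1 h2).analyticOnNhd hopen
  have hg : AnalyticOnNhd ℂ (fun s => expRemInt β 1 * s ^ (β : ℂ)) {s | 0 < s.re} := by
    refine DifferentiableOn.analyticOnNhd (fun s hs => ?_) hopen
    exact ((differentiableAt_id.cpow (differentiableAt_const _)
      (Or.inl hs)).const_mul _).differentiableWithinAt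
  refine hf.eqOn_of_preconnected_of_frequently_eq hg (convex_halfSpace_re_gt 0).isPreconnected
    (z₀ := 1) (by simp) ?_ hs
  have ht : Tendsto (fun r : ℝ => (r : ℂ)) (𝓝[>] 1) (𝓝[≠] (1 : ℂ)) := by
    refine tendsto_nhdsWithin_iff.2 ⟨?_, ?_⟩
    · have : Tendsto (fun r : ℝ => (r : ℂ)) (𝓝 1) (𝓝 ((1 : ℝ) : ℂ)) :=
        Complex.continuous_ofReal.tendsto 1
      rw [Complex.ofReal_one] at this
      exact this.mono_left nhdsWithin_le_nhds
    · filter_upwards [self_mem_nhdsWithin] with r hr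
      have : r ≠ 1 := ne_of_gt hr
      simpa using this
  refine ht.frequently (Eventually.frequently ?_)
  filter_upwards [self_mem_nhdsWithin] with r hr
  exact A_ofReal (one_pos.trans hr)

theorem A_eq' {β : ℝ} (h1 : 1 < β) (h2 : β < 2) {s : ℂ} (hs : 0 ≤ s.re) (h0 : s ≠ 0) :
    expRemInt β s = expRemInt β 1 * s ^ (β : ℂ) := by
  have hslit : s ∈ Complex.slitPlane := by
    rcases hs.lt_or_eq with h | h
    · exact Or.inl h
    · exact Or.inr fun h' => h0 (Complex.ext h.symm h')
  have hl : Tendsto (fun ε : ℝ => s + ε) (𝓝[>] 0) (𝓝 s) := by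
    have : Tendsto (fun ε : ℝ => s + ε) (𝓝 0) (𝓝 (s + (0:ℝ))) :=
      Continuous.tendsto (by fun_prop) 0
    rw [Complex.ofReal_zero, add_zero] at this
    exact this.mono_left nhdsWithin_le_nhds
  have hl' : Tendsto (fun ε : ℝ => s + ε) (𝓝[>] 0) (𝓝[{s | 0 ≤ s.re}] s) := by
    refine tendsto_nhdsWithin_iff.2 ⟨hl, ?_⟩
    filter_upwards [self_mem_nhdsWithin] with ε (hε : 0 < ε)
    simp; linarith
  have t1 := (continuousOn_A h1 h2 s hs).tendsto.comp hl'
  have t2 : Tendsto (fun ε : ℝ => expRemInt β 1 * (s + ε) ^ (β : ℂ)) (𝓝[>] 0) (𝓝 (expRemInt β 1 * s ^ (β : ℂ))) :=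
    ((continuousAt_cpow_const hslit).tendsto.comp hl).const_mul _
  refine tendsto_nhds_unique t1 (t2.congr' ?_)
  filter_upwards [self_mem_nhdsWithin] with ε (hε : 0 < ε)
  exact (A_eq h1 h2 (by simp; linarith)).symm
theorem A_one {β : ℝ} (h1 : 1 < β) (h2 : β < 2) : expRemInt β 1 = (Real.Gamma (-β) : ℂ) := by
  have hβ : (β : ℂ) ≠ 0 := by exact_mod_cast (by linarith : β ≠ 0)
  have hβ1 : (1 - β : ℂ) ≠ 0 := by exact_mod_cast (by linarith : 1 - β ≠ 0)
  set H : ℝ → ℂ := fun z => -(expRem z * ((z ^ (-β) : ℝ) : ℂ)) / β +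
    (1 - Complex.exp (-z)) * ((z ^ (1 - β) : ℝ) : ℂ) / (β * (1 - β)) with hH
  set H' : ℝ → ℂ := fun z => expRem (1 * z) * ((z ^ (-1 - β) : ℝ) : ℂ) +
    ((Real.exp (-z) * z ^ ((2 - β) - 1) : ℝ) : ℂ) / (β * (1 - β)) with hH'
  have hd : ∀ z ∈ Ioi (0:ℝ), HasDerivAt H (H' z) z := by
    intro z (hz : 0 < z)
    have a1 := (hasDerivAt_K z).comp_ofReal
    have a2 := (Real.hasDerivAt_rpow_const (x := z) (p := -β) (Or.inl hz.ne')).ofReal_comp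
    have a3 := (Real.hasDerivAt_rpow_const (x := z) (p := 1 - β) (Or.inl hz.ne')).ofReal_comp
    have a4 := (((hasDerivAt_neg (z : ℂ)).cexp).const_sub 1).comp_ofReal
    have h := ((a1.mul a2).neg.div_const (β : ℂ)).add ((a4.mul a3).div_const ((β : ℂ) * (1 - β)))
    refine h.congr_deriv ?_
    have e2 : z ^ (-β) = z * z ^ (-1 - β) := by
      nth_rewrite 2 [← Real.rpow_one z]; rw [← Real.rpow_add hz]; congr 1; ring
    have e3 : (1 : ℝ) - β - 1 = -β := by ring
    have e4 : -β - 1 = -1 - β := by ring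
    have e5 : (2 : ℝ) - β - 1 = 1 - β := by ring
    simp only [hH', e3, e4, e5]
    push_cast
    rw [one_mul]
    field_simp
    ring
  have hb : ∀ z : ℝ, 0 ≤ z → ‖H z‖ ≤ (1 / β + 1 / (β * (β - 1))) * z ^ (2 - β) := by
    intro z hz
    rcases hz.eq_or_lt with rfl | hz
    · simp [hH, expRem]
      rw [Real.zero_rpow (by linarith)]; simp
    have hre : 0 ≤ (z : ℂ).re := by simpa using hz.le
    have b1 := norm_K_le_sq hre
    have b2 := norm_one_sub_exp_le hre
    have hn : ‖(z : ℂ)‖ = z := by simp [abs_of_pos hz]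
    rw [hn] at b1 b2
    have e1 : z ^ (2 - β) = z ^ 2 * z ^ (-β) := by
      rw [← Real.rpow_natCast, ← Real.rpow_add hz]; congr 1
    have e2 : z ^ (2 - β) = z * z ^ (1 - β) := by
      nth_rewrite 2 [← Real.rpow_one z]; rw [← Real.rpow_add hz]; congr 1; ring
    have n1 : ‖(β : ℂ)‖ = β := by simp [abs_of_pos (by linarith : 0 < β)]
    have n2 : ‖(1 - β : ℂ)‖ = β - 1 := by
      rw [← Complex.ofReal_one, ← Complex.ofReal_sub, Complex.norm_real, Real.norm_eq_abs,
        abs_of_neg (by linarith)]; ring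
    refine (norm_add_le _ _).trans ?_
    rw [norm_div, norm_div, norm_neg, norm_mul, norm_mul, norm_mul, n1, n2, Complex.norm_real,
      Complex.norm_real, Real.norm_of_nonneg (Real.rpow_nonneg hz.le _),
      Real.norm_of_nonneg (Real.rpow_nonneg hz.le _), add_mul]
    have hp : 0 < β - 1 := by linarith
    have p1 := Real.rpow_nonneg hz.le (-β)
    have p2 := Real.rpow_nonneg hz.le (1 - β)
    refine add_le_add ?_ ?_
    · rw [e1, one_div_mul_eq_div]
      gcongr
    · rw [e2, one_div_mul_eq_div]
      gcongr
  have hb' : ∀ z : ℝ, 0 < z → ‖H z‖ ≤ (2 / β + 2 / (β * (β - 1))) * z ^ (-(β - 1)) := by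
    intro z hz
    have hre : 0 ≤ (z : ℂ).re := by simpa using hz.le
    have b1 := norm_K_le hre
    have b2 := norm_one_sub_exp_le_two hre
    have hn : ‖(z : ℂ)‖ = z := by simp [abs_of_pos hz]
    rw [hn] at b1
    have e1 : z ^ (1 - β) = z * z ^ (-β) := by
      nth_rewrite 2 [← Real.rpow_one z]; rw [← Real.rpow_add hz]; congr 1
    have n1 : ‖(β : ℂ)‖ = β := by simp [abs_of_pos (by linarith : 0 < β)]
    have n2 : ‖(1 - β : ℂ)‖ = β - 1 := by
      rw [← Complex.ofReal_one, ← Complex.ofReal_sub, Complex.norm_real, Real.norm_eq_abs,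
        abs_of_neg (by linarith)]; ring
    refine (norm_add_le _ _).trans ?_
    rw [norm_div, norm_div, norm_neg, norm_mul, norm_mul, norm_mul, n1, n2, Complex.norm_real,
      Complex.norm_real, Real.norm_of_nonneg (Real.rpow_nonneg hz.le _),
      Real.norm_of_nonneg (Real.rpow_nonneg hz.le _), add_mul, neg_sub]
    have hp : 0 < β - 1 := by linarith
    have p1 := Real.rpow_nonneg hz.le (-β)
    have p2 := Real.rpow_nonneg hz.le (1 - β)
    refine add_le_add ?_ ?_
    · rw [e1, div_mul_eq_mul_div, ← mul_assoc]
      gcongr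
    · rw [div_mul_eq_mul_div]
      gcongr
  have hH0 : H 0 = 0 := by simp [hH, expRem]
  have hcont : ContinuousWithinAt H (Ici 0) 0 := by
    unfold ContinuousWithinAt
    rw [hH0]
    refine squeeze_zero_norm' (a := fun z => (1 / β + 1 / (β * (β - 1))) * z ^ (2 - β)) ?_ ?_
    · filter_upwards [self_mem_nhdsWithin] with z hz using hb z hz
    · have : Tendsto (fun z : ℝ => (1 / β + 1 / (β * (β - 1))) * z ^ (2 - β)) (𝓝 0)
          (𝓝 ((1 / β + 1 / (β * (β - 1))) * 0 ^ (2 - β))) :=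
        ((Real.continuousAt_rpow_const 0 (2 - β) (Or.inr (by linarith))).tendsto).const_mul _
      rw [Real.zero_rpow (by linarith), mul_zero] at this
      exact this.mono_left nhdsWithin_le_nhds
  have hinf : Tendsto H atTop (𝓝 0) := by
    refine squeeze_zero_norm'
      (a := fun z => (2 / β + 2 / (β * (β - 1))) * z ^ (-(β - 1))) ?_ ?_
    · filter_upwards [eventually_gt_atTop 0] with z hz using hb' z hz
    · simpa using (tendsto_rpow_neg_atTop (by linarith : 0 < β - 1)).const_mul
        (2 / β + 2 / (β * (β - 1)))
  have i1 := integrable_A h1 h2 (s := 1) (by simp)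
  have i2 : IntegrableOn (fun z : ℝ => ((Real.exp (-z) * z ^ ((2 - β) - 1) : ℝ) : ℂ)) (Ioi 0) :=
    (Real.GammaIntegral_convergent (by linarith : 0 < 2 - β)).ofReal
  have i2' := i2.div_const ((β : ℂ) * (1 - β))
  have := integral_Ioi_of_hasDerivAt_of_tendsto hcont hd (i1.add i2') hinf
  rw [hH0, sub_zero, integral_add i1 i2', integral_div, integral_complex_ofReal,
    ← Real.Gamma_eq_integral (by linarith)] at this
  have g1 : Real.Gamma (2 - β) = (1 - β) * (-β * Real.Gamma (-β)) := by
    have e1 : (2 : ℝ) - β = (1 - β) + 1 := by ring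
    have e2 : (1 : ℝ) - β = (-β) + 1 := by ring
    rw [e1, Real.Gamma_add_one (by linarith), e2, Real.Gamma_add_one (by linarith)]
  rw [g1] at this
  push_cast at this
  have e : ((1 : ℂ) - β) * (-β * (Real.Gamma (-β) : ℂ)) / (β * (1 - β)) = -(Real.Gamma (-β) : ℂ) := by
    field_simp
  rw [e] at this
  exact eq_of_sub_eq_zero (by simpa [expRemInt, sub_eq_add_neg] using this)

theorem trig_id (a g : ℂ) : Complex.sin (a - g) * Complex.exp (-(a * Complex.I)) +
    Complex.sin (a + g) * Complex.exp (a * Complex.I) = Complex.sin (2 * a) *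
      Complex.exp (g * Complex.I) := by
  rw [← neg_mul, Complex.exp_mul_I, Complex.exp_mul_I, Complex.exp_mul_I, Complex.sin_sub,
    Complex.sin_add, Complex.sin_two_mul, Complex.cos_neg, Complex.sin_neg]
  ring

theorem symbol_eq {β γ : ℝ} (h1 : 1 < β) (h2 : β < 2) (ξ : ℝ) :
    cOne β γ * expRemInt β (-(Complex.I * ξ)) + cTwo β γ * expRemInt β (Complex.I * ξ) = symbol β γ ξ := by
  have hs : Real.sin (Real.pi * β) ≠ 0 := by
    have : Real.sin (Real.pi * β - Real.pi) ≠ 0 := by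
      refine (Real.sin_pos_of_pos_of_lt_pi ?_ ?_).ne' <;> nlinarith [Real.pi_pos]
    rw [Real.sin_sub_pi] at this
    simpa using this
  have hG : Real.Gamma (-β) * Real.Gamma (1 + β) = - Real.pi / Real.sin (Real.pi * β) := by
    have := Real.Gamma_mul_Gamma_one_sub (-β)
    rw [sub_neg_eq_add, mul_neg, Real.sin_neg] at this
    rw [this, div_neg, neg_div]
  have hc : ∀ a g : ℝ, Complex.sin (a - g) * Complex.exp (-(a * Complex.I)) +
      Complex.sin (a + g) * Complex.exp (a * Complex.I) = Complex.sin (2 * a) *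
      Complex.exp (g * Complex.I) := fun a g => trig_id a g
  have key : ∀ g : ℝ, (Real.Gamma (-β) : ℂ) * (cOne β g * Complex.exp (-((β * Real.pi / 2 : ℝ) * Complex.I))
      + cTwo β g * Complex.exp ((β * Real.pi / 2 : ℝ) * Complex.I))
      = - Complex.exp ((g * Real.pi / 2 : ℝ) * Complex.I) := by
    intro g
    have := hc (β * Real.pi / 2) (g * Real.pi / 2)
    have e1 : ((β - g) * Real.pi / 2) = β * Real.pi / 2 - g * Real.pi / 2 := by ring
    have e2 : ((β + g) * Real.pi / 2) = β * Real.pi / 2 + g * Real.pi / 2 := by ring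
    have e3 : Real.pi * β = 2 * (β * Real.pi / 2) := by ring
    rw [e3] at hs hG
    unfold cOne cTwo
    rw [e1, e2]
    generalize β * Real.pi / 2 = a at *
    generalize g * Real.pi / 2 = b at *
    have hG' : (Real.Gamma (-β) : ℂ) * (Real.Gamma (1 + β) : ℂ) = - Real.pi / Complex.sin (2 * a) := by
      exact_mod_cast congrArg (fun x : ℝ => (x : ℂ)) hG
    have hs' : Complex.sin (2 * a) ≠ 0 := by exact_mod_cast hs
    have hpi : (Real.pi : ℂ) ≠ 0 := by exact_mod_cast Real.pi_ne_zero
    push_cast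
    calc _ = ((Real.Gamma (-β) : ℂ) * (Real.Gamma (1 + β) : ℂ)) / Real.pi *
        (Complex.sin (a - b) * Complex.exp (-(a * Complex.I)) +
          Complex.sin (a + b) * Complex.exp (a * Complex.I)) := by ring
      _ = _ := by
        rw [this, hG']; field_simp
  have hI : ∀ r : ℝ, 0 < r → expRemInt β (Complex.I * r) =
      Real.Gamma (-β) * (((r ^ β : ℝ) : ℂ) * Complex.exp ((β * Real.pi / 2 : ℝ) * Complex.I)) := by
    intro r hr
    have hr0 : (r : ℂ) ≠ 0 := by exact_mod_cast hr.ne'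
    rw [A_eq' h1 h2 (by simp) (by simp [hr.ne']), A_one h1 h2, mul_comm Complex.I,
      Complex.ofReal_cpow hr.le, Complex.cpow_def_of_ne_zero (by simp [hr.ne']),
      Complex.cpow_def_of_ne_zero hr0, Complex.log_ofReal_mul hr Complex.I_ne_zero, Complex.log_I,
      ← Complex.exp_add, Complex.ofReal_log hr.le]
    congr 2
    push_cast; ring
  have hI' : ∀ r : ℝ, 0 < r → expRemInt β (-(Complex.I * r)) =
      Real.Gamma (-β) * (((r ^ β : ℝ) : ℂ) * Complex.exp (-((β * Real.pi / 2 : ℝ) * Complex.I))) := by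
    intro r hr
    have hr0 : (r : ℂ) ≠ 0 := by exact_mod_cast hr.ne'
    have e : -(Complex.I * r) = r * (-Complex.I) := by ring
    rw [A_eq' h1 h2 (by simp) (by simp [hr.ne']), A_one h1 h2, e,
      Complex.ofReal_cpow hr.le, Complex.cpow_def_of_ne_zero (by simp [hr.ne']),
      Complex.cpow_def_of_ne_zero hr0, Complex.log_ofReal_mul hr (neg_ne_zero.2 Complex.I_ne_zero),
      Complex.log_neg_I, ← Complex.exp_add, Complex.ofReal_log hr.le]
    congr 2
    push_cast; ring
  rcases lt_trichotomy ξ 0 with h | rfl | h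
  · have e1 : Complex.I * ξ = -(Complex.I * ((-ξ : ℝ) : ℂ)) := by push_cast; ring
    have e2 : cOne β γ = cTwo β (-γ) := by unfold cOne cTwo; ring_nf
    have e3 : cTwo β γ = cOne β (-γ) := by unfold cOne cTwo; ring_nf
    have k := key (-γ)
    rw [e1, neg_neg, hI _ (neg_pos.2 h), hI' _ (neg_pos.2 h), symbol, Real.sign_of_neg h,
      abs_of_neg h, e2, e3]
    have e4 : Complex.I * ((-1 : ℝ) * γ * (Real.pi / 2)) = ((-γ * Real.pi / 2 : ℝ) : ℂ) * Complex.I := by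
      push_cast; ring
    rw [e4]
    linear_combination (((-ξ) ^ β : ℝ) : ℂ) * k
  · have : expRemInt β 0 = 0 := by simp [expRemInt, expRem]
    simp [symbol, this, Real.zero_rpow (by linarith : β ≠ 0)]
  · have k := key γ
    rw [hI _ h, hI' _ h, symbol, Real.sign_of_pos h, abs_of_pos h]
    have e4 : Complex.I * ((1 : ℝ) * γ * (Real.pi / 2)) = ((γ * Real.pi / 2 : ℝ) : ℂ) * Complex.I := by
      push_cast; ring
    rw [e4]
    linear_combination ((ξ ^ β : ℝ) : ℂ) * k

theorem integrable_pow_mul (W : 𝓢(ℝ, ℂ)) (n : ℕ) : Integrable fun η : ℝ => |η| ^ n * ‖W η‖ := by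
  simpa using W.integrable_pow_mul volume n

theorem prod_integrable {β : ℝ} (h1 : 1 < β) (h2 : β < 2) (W : 𝓢(ℝ, ℂ)) (x σ : ℝ) :
    Integrable (fun p : ℝ × ℝ => Complex.exp (Complex.I * (2 * Real.pi * p.2) * x) * W p.2 *
      (expRem (-(Complex.I * (σ * p.2)) * p.1) * ((p.1 ^ (-1 - β) : ℝ) : ℂ)))
      ((volume.restrict (Ioi (0:ℝ))).prod volume) := by
  have hd := integrableOn_dom (a := 1 - β) (b := -β) (by linarith) (by linarith)
  have hW : Integrable fun η : ℝ => (‖W η‖ * (|σ| ^ 2 * |η| ^ 2 + 2 * (|σ| * |η|))) := by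
    have := ((integrable_pow_mul W 2).const_mul (|σ| ^ 2)).add
      ((integrable_pow_mul W 1).const_mul (2 * |σ|))
    refine this.congr (ae_of_all _ fun η => ?_)
    simp only [Pi.add_apply]; ring
  refine (Integrable.mul_prod hd hW).mono' ?_ ?_
  · refine Measurable.aestronglyMeasurable ?_
    have m1 := continuous_K.measurable
    have m2 : Measurable fun p : ℝ × ℝ => W p.2 := (W.continuous.comp continuous_snd).measurable
    refine Measurable.mul (Measurable.mul (by fun_prop) m2) (Measurable.mul ?_ (by fun_prop))
    exact m1.comp (by fun_prop)
  · have : ∀ᵐ p : ℝ × ℝ ∂((volume.restrict (Ioi (0:ℝ))).prod volume), p.1 ∈ Ioi (0:ℝ) :=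
      Measure.quasiMeasurePreserving_fst.ae (ae_restrict_mem measurableSet_Ioi)
    filter_upwards [this] with p hp
    have hb := norm_K_mul_le (β := β) (s := -(Complex.I * (σ * p.2))) (z := p.1) (by simp) hp
    have hn : ‖-(Complex.I * ((σ : ℂ) * p.2))‖ = |σ| * |p.2| := by simp
    have he : ‖Complex.exp (Complex.I * (2 * Real.pi * p.2) * x)‖ = 1 := by
      rw [Complex.norm_exp]; simp
    rw [hn] at hb
    rw [norm_mul, norm_mul, he, one_mul]
    refine (mul_le_mul_of_nonneg_left hb (norm_nonneg _)).trans (le_of_eq ?_)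
    ring

theorem fub {β : ℝ} (h1 : 1 < β) (h2 : β < 2) (W : 𝓢(ℝ, ℂ)) (x σ : ℝ) :
    ∫ z in Ioi (0:ℝ), (∫ η : ℝ, Complex.exp (Complex.I * (2 * Real.pi * η) * x) * W η *
      expRem (-(Complex.I * (σ * η)) * z)) * ((z ^ (-1 - β) : ℝ) : ℂ) =
    ∫ η : ℝ, Complex.exp (Complex.I * (2 * Real.pi * η) * x) * W η *
      expRemInt β (-(Complex.I * (σ * η))) := by
  have := integral_integral_swap (μ := volume.restrict (Ioi (0:ℝ))) (ν := volume)
    (f := fun z η : ℝ => Complex.exp (Complex.I * (2 * Real.pi * η) * x) * W η *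
      (expRem (-(Complex.I * (σ * η)) * z) * ((z ^ (-1 - β) : ℝ) : ℂ)))
    (prod_integrable h1 h2 W x σ)
  simp only [expRemInt, ← integral_mul_const, ← integral_const_mul]
  rw [← this]
  simp only [mul_assoc]

theorem fub_int {β : ℝ} (h1 : 1 < β) (h2 : β < 2) (W : 𝓢(ℝ, ℂ)) (x σ : ℝ) :
    Integrable fun η : ℝ => Complex.exp (Complex.I * (2 * Real.pi * η) * x) * W η *
      expRemInt β (-(Complex.I * (σ * η))) := by
  have := (prod_integrable h1 h2 W x σ).integral_prod_right
  simpa only [expRemInt, ← integral_const_mul] using this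

theorem inv_formula (g : 𝓢(ℝ, ℂ)) (y : ℝ) :
    g y = ∫ η : ℝ, Complex.exp (Complex.I * (2 * Real.pi * η) * y) * (𝓕 g) η := by
  have h : 𝓕⁻ (𝓕 g) = g := FourierTransform.fourierInv_fourier_eq g
  conv_lhs => rw [← h]
  rw [SchwartzMap.fourierInv_coe, Real.fourierInv_eq']
  refine integral_congr_ae (ae_of_all _ fun η => ?_)
  simp only [smul_eq_mul]
  congr 2
  simp; ring

theorem rem_formula (v : 𝓢(ℝ, ℝ)) (x σ z : ℝ) :
    ((v (x + σ * z) - v x - deriv v x * (σ * z) : ℝ) : ℂ) =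
      ∫ η : ℝ, Complex.exp (Complex.I * (2 * Real.pi * η) * x) *
        (𝓕 (SchwartzMap.postcompCLM Complex.ofRealCLM v) : 𝓢(ℝ, ℂ)) η *
        expRem (-(Complex.I * (((2 * Real.pi * σ : ℝ) : ℂ) * η)) * z) := by
  set g : 𝓢(ℝ, ℂ) := SchwartzMap.postcompCLM Complex.ofRealCLM v with hg
  have hgv : ∀ y, ((v y : ℝ) : ℂ) = g y := fun y => by simp [hg]
  have hdv : ((deriv v x : ℝ) : ℂ) = SchwartzMap.derivCLM ℂ ℂ g x := by
    rw [SchwartzMap.derivCLM_apply]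
    have := (v.differentiableAt (x := x)).hasDerivAt.ofReal_comp
    rw [← this.deriv]
    congr 1
  have hF : ∀ η, (𝓕 (SchwartzMap.derivCLM ℂ ℂ g) : 𝓢(ℝ, ℂ)) η =
      2 * Real.pi * Complex.I * η * (𝓕 g : 𝓢(ℝ, ℂ)) η := by
    intro η
    rw [SchwartzMap.fourier_coe, SchwartzMap.fourier_coe]
    have hdg : ⇑(SchwartzMap.derivCLM ℂ ℂ g) = deriv g := by
      ext y; exact SchwartzMap.derivCLM_apply ..
    have := Real.fourier_deriv g.integrable g.differentiable
      (by rw [← hdg]; exact SchwartzMap.integrable _)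
    rw [hdg, this]; rfl
  have i1 : ∀ h : 𝓢(ℝ, ℂ), ∀ y : ℝ, Integrable fun η : ℝ =>
      Complex.exp (Complex.I * (2 * Real.pi * η) * y) * h η := by
    intro h y
    refine h.integrable.norm.mono' (Continuous.aestronglyMeasurable ?_) (ae_of_all _ fun η => ?_)
    · have := h.continuous
      fun_prop
    · rw [norm_mul, Complex.norm_exp]; simp
  have j1 := i1 (𝓕 g) (x + σ * z)
  have j2 := i1 (𝓕 g) x
  have j3 := i1 (𝓕 (SchwartzMap.derivCLM ℂ ℂ g)) x
  have j12 : Integrable fun η : ℝ =>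
      Complex.exp (Complex.I * (2 * Real.pi * η) * ((x + σ * z : ℝ) : ℂ)) * (𝓕 g) η -
        Complex.exp (Complex.I * (2 * Real.pi * η) * x) * (𝓕 g) η := j1.sub j2
  rw [Complex.ofReal_sub, Complex.ofReal_sub, Complex.ofReal_mul (deriv v x), hdv, hgv, hgv, inv_formula g, inv_formula g x,
    inv_formula (SchwartzMap.derivCLM ℂ ℂ g), ← integral_mul_const,
    ← integral_sub j1 j2, ← integral_sub j12 (j3.mul_const _)]
  refine integral_congr_ae (ae_of_all _ fun η => ?_)
  simp only [hF, expRem]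
  have e : Complex.exp (Complex.I * (2 * Real.pi * η) * ((x + σ * z : ℝ) : ℂ)) =
      Complex.exp (Complex.I * (2 * Real.pi * η) * x) *
      Complex.exp (-(-(Complex.I * (((2 * Real.pi * σ : ℝ) : ℂ) * η)) * z)) := by
    rw [← Complex.exp_add]; congr 1; push_cast; ring
  rw [e]
  push_cast
  ring

/-- For Schwartz functions the singular integral `rieszFeller β γ` is the Fourier multiplier
operator with symbol `symbol β γ`, that is `𝓕(D v) = ψ 𝓕 v`. This certifies the values of the
constants `cOne`, `cTwo`. -/
theorem rieszFeller_eq_fourier {β γ : ℝ} (h1 : 1 < β) (h2 : β < 2) (v : 𝓢(ℝ, ℝ)) (x : ℝ) :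
    ((rieszFeller β γ v x : ℝ) : ℂ) =
      fourierTInv (fun ξ => symbol β γ ξ * fourierT (fun y => ((v y : ℝ) : ℂ)) ξ) x := by
  set g : 𝓢(ℝ, ℂ) := SchwartzMap.postcompCLM Complex.ofRealCLM v with hg
  have piece : ∀ σ : ℝ, (((∫ z in Ioi (0 : ℝ),
      (v (x + σ * z) - v x - deriv v x * (σ * z)) / z ^ (1 + β) : ℝ)) : ℂ) =
      ∫ η : ℝ, Complex.exp (Complex.I * (2 * Real.pi * η) * x) * (𝓕 g) η *
      expRemInt β (-(Complex.I * (((2 * Real.pi * σ : ℝ) : ℂ) * η))) := by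
    intro σ
    rw [← fub h1 h2, ← integral_complex_ofReal]
    refine setIntegral_congr_fun measurableSet_Ioi fun z (hz : 0 < z) => ?_
    have e : z ^ (-1 - β) = (z ^ (1 + β))⁻¹ := by
      rw [← Real.rpow_neg hz.le]; congr 1; ring
    rw [← rem_formula, e, div_eq_mul_inv]
    push_cast; ring
  have hop : rieszFeller β γ v x =
      cOne β γ * (∫ z in Ioi (0 : ℝ), (v (x + 1 * z) - v x - deriv v x * (1 * z)) / z ^ (1 + β)) +
      cTwo β γ * (∫ z in Ioi (0 : ℝ),
        (v (x + (-1) * z) - v x - deriv v x * ((-1) * z)) / z ^ (1 + β)) := by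
    unfold rieszFeller
    congr 3
    · simp
    · funext z; congr 1; ring_nf
  rw [hop]
  simp only [Complex.ofReal_add, Complex.ofReal_mul]
  rw [piece, piece, ← integral_const_mul, ← integral_const_mul,
    ← integral_add ((fub_int h1 h2 _ x _).const_mul _) ((fub_int h1 h2 _ x _).const_mul _)]
  have hsq : ((√(2 * Real.pi) : ℝ) : ℂ) * ((√(2 * Real.pi) : ℝ) : ℂ) = 2 * Real.pi := by
    rw [← Complex.ofReal_mul, Real.mul_self_sqrt (by positivity)]; push_cast; rfl
  have hsq0 : ((√(2 * Real.pi) : ℝ) : ℂ) ≠ 0 := by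
    have : √(2 * Real.pi) ≠ 0 := by positivity
    exact_mod_cast this
  have hF : ∀ η : ℝ, (𝓕 g) η = ((√(2 * Real.pi) : ℝ) : ℂ) *
      fourierT (fun y => ((v y : ℝ) : ℂ)) (2 * Real.pi * η) := by
    intro η
    rw [SchwartzMap.fourier_coe, Real.fourier_eq', fourierT, ← mul_assoc, ← Complex.ofReal_mul,
      mul_one_div_cancel (by positivity), Complex.ofReal_one, one_mul]
    refine integral_congr_ae (ae_of_all _ fun y => ?_)
    simp only [smul_eq_mul, hg, SchwartzMap.postcompCLM_apply]
    rw [mul_comm]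
    congr 2
    simp; ring
  have hsub := Measure.integral_comp_mul_left (fun ξ : ℝ => symbol β γ ξ *
    fourierT (fun y => ((v y : ℝ) : ℂ)) ξ * Complex.exp (Complex.I * ξ * x)) (2 * Real.pi)
  have h2pi : ((2 * Real.pi : ℝ) : ℂ) = ((√(2 * Real.pi) : ℝ) : ℂ) * ((√(2 * Real.pi) : ℝ) : ℂ) := by
    rw [hsq]; push_cast; rfl
  unfold fourierTInv
  rw [abs_of_pos (by positivity), Complex.real_smul, Complex.ofReal_inv, h2pi,
    eq_inv_mul_iff_mul_eq₀ (mul_ne_zero hsq0 hsq0)] at hsub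
  rw [← hsub, ← mul_assoc, ← mul_assoc, ← Complex.ofReal_mul, one_div_mul_cancel (by positivity),
    Complex.ofReal_one, one_mul, ← integral_const_mul]
  refine integral_congr_ae (ae_of_all _ fun η => ?_)
  have hs := symbol_eq (γ := γ) h1 h2 (2 * Real.pi * η)
  have a1 : -(Complex.I * (((2 * Real.pi * 1 : ℝ) : ℂ) * η)) =
    -(Complex.I * ((2 * Real.pi * η : ℝ) : ℂ)) := by push_cast; ring
  have a2 : -(Complex.I * (((2 * Real.pi * (-1) : ℝ) : ℂ) * η)) =
    Complex.I * ((2 * Real.pi * η : ℝ) : ℂ) := by push_cast; ring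
  beta_reduce
  rw [a1, a2, hF, ← hs]
  push_cast
  ring

end RieszFeller

namespace RieszFeller

/-! ### First order Taylor remainders -/

/-! Suppose first that `η` is C¹. Multiplying the equation by `φ η'(u)` and using `q' = f' η'` turns
the integrand into a space-time divergence of functions compactly supported in the open half-plane,
plus `η(u) D̄[φ] - φ η'(u) D[u]` (`entropyIntegrand_eq`). The divergence integrates to zero, so what
remains is, at each fixed time, the nonlocal inequality `∫ g η'(v) D[v] ≤ ∫ η(v) D̄[g]` for `g ≥ 0`
(`integral_mul_rieszFeller_le`).

That inequality already holds for each jump length `z`. Since `η` lies above its tangents, `η'(v)`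
times the Taylor remainder of `v` is at most the Taylor remainder of `η ∘ v`. Testing against `g`, a
translation and an integration by parts move the remainder onto `g` and reverse the direction of the
jump (`integral_mul_taylorRem_le`). Dividing by `z ^ (1 + β)` and integrating over `z` gives a bound
for each half-line (`integral_mul_halfLineInt_le`). The two bounds are added with weights that are
nonnegative precisely because of the restriction on `γ`. Because `x` is integrated before `z`, no
second derivative of `η ∘ v` is ever needed.

The adjoint is defined through fractional derivatives. Two integrations by parts show that on test
functions it is the same singular integral with the two half-lines exchanged (`halfLineInt_eq`,
`rieszFellerAdj_eq`).

A merely continuous convex `η` is approximated, uniformly on the range of `u`, by C¹ convex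
functions (`exists_contDiff_convexOn_approx`). The integrand is linear in `η` and, through the given
form of `q`, controlled by the size of `η` on that range without any derivative of `η`
(`exists_abs_entropyFlux_sub_le`), so the inequality survives the limit. -/

/-- The remainder `v (x + σ z) - v x - v' x σ z`. -/
noncomputable def taylorRem (σ : ℝ) (v : ℝ → ℝ) (x z : ℝ) : ℝ :=
  v (x + σ * z) - v x - deriv v x * (σ * z)

/-- The singular integral along the half-line in direction `σ`. -/
noncomputable def halfLineInt (β σ : ℝ) (v : ℝ → ℝ) (x : ℝ) : ℝ :=
  ∫ z in Ioi (0 : ℝ), taylorRem σ v x z / z ^ (1 + β)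

theorem rieszFeller_eq_halfLineInt (β γ : ℝ) (v : ℝ → ℝ) (x : ℝ) :
    rieszFeller β γ v x =
      cOne β γ * halfLineInt β 1 v x + cTwo β γ * halfLineInt β (-1) v x := by
  unfold rieszFeller halfLineInt taylorRem
  congr 3
  · simp
  · funext z; congr 1; ring_nf

theorem domFun_nonneg {a b z : ℝ} (hz : 0 < z) : 0 ≤ domFun a b z :=
  le_min (Real.rpow_nonneg hz.le _) (Real.rpow_nonneg hz.le _)

theorem min_sq_self_div_rpow {β z : ℝ} (hz : 0 < z) :
    min (z ^ 2) z / z ^ (1 + β) = domFun (1 - β) (-β) z := by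
  have hp : 0 ≤ (z ^ (1 + β))⁻¹ := inv_nonneg.2 (Real.rpow_nonneg hz.le _)
  have e1 : z ^ (1 - β) = z ^ 2 * (z ^ (1 + β))⁻¹ := by
    rw [← Real.rpow_natCast, ← Real.rpow_neg hz.le, ← Real.rpow_add hz]
    congr 1; push_cast; ring
  have e2 : z ^ (-β) = z * (z ^ (1 + β))⁻¹ := by
    nth_rewrite 2 [← Real.rpow_one z]
    rw [← Real.rpow_neg hz.le, ← Real.rpow_add hz]; congr 1; ring
  rw [div_eq_mul_inv, domFun, e1, e2, min_mul_of_nonneg _ _ hp]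

theorem abs_sub_le_of_abs_deriv_le {v : ℝ → ℝ} {M : ℝ} (hv : Differentiable ℝ v)
    (hM : ∀ x, |deriv v x| ≤ M) (x y : ℝ) : |v y - v x| ≤ M * |y - x| := by
  simpa using convex_univ.norm_image_sub_le_of_norm_deriv_le (f := v) (C := M) (x := x) (y := y)
    (fun x _ => hv x) (fun x _ => hM x) (mem_univ _) (mem_univ _)

/-- The remainder vanishes at `z = 0` and its derivative in `z` is an increment of `v'`, of size at
most `M * z` on `[0, z]`. The mean value inequality loses the factor 1/2, which is harmless. -/
theorem abs_taylorRem_le_sq {v : ℝ → ℝ} {M : ℝ} (hv : ContDiff ℝ 2 v)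
    (hM : ∀ x, |deriv (deriv v) x| ≤ M) {σ : ℝ} (hσ : |σ| = 1) (x : ℝ) {z : ℝ} (hz : 0 < z) :
    |taylorRem σ v x z| ≤ M * z ^ 2 := by
  have hv' : Differentiable ℝ (deriv v) :=
    ((contDiff_succ_iff_deriv (n := 1)).1 hv).2.2.differentiable one_ne_zero
  have hvd : Differentiable ℝ v := hv.differentiable two_ne_zero
  have hM0 : 0 ≤ M := (abs_nonneg _).trans (hM 0)
  have h := (convex_Icc (0 : ℝ) z).norm_image_sub_le_of_norm_hasDerivWithin_le
    (f := taylorRem σ v x) (f' := fun s => (deriv v (x + σ * s) - deriv v x) * σ) (C := M * z)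
    (x := 0) (y := z) (fun s _ => by
      have h1 : HasDerivAt (fun s : ℝ => x + σ * s) σ s := by
        simpa using ((hasDerivAt_id s).const_mul σ).const_add x
      have h2 := (((hvd _).hasDerivAt.comp s h1).sub_const (v x)).sub
        (((hasDerivAt_id s).const_mul σ).const_mul (deriv v x))
      refine (h2.congr_deriv ?_).hasDerivWithinAt
      ring)
    (fun s hs => by
      have := abs_sub_le_of_abs_deriv_le hv' hM x (x + σ * s)
      rw [add_sub_cancel_left, abs_mul, hσ, one_mul, abs_of_nonneg hs.1] at this
      rw [Real.norm_eq_abs, abs_mul, hσ, mul_one]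
      exact this.trans (by gcongr; exact hs.2))
    (by simp [hz.le]) (by simp [hz.le])
  simpa [taylorRem, abs_of_pos hz, pow_two, mul_assoc] using h

theorem abs_taylorRem_le {v : ℝ → ℝ} {M : ℝ} (hv : Differentiable ℝ v)
    (hM : ∀ x, |deriv v x| ≤ M) {σ : ℝ} (hσ : |σ| = 1) (x : ℝ) {z : ℝ} (hz : 0 < z) :
    |taylorRem σ v x z| ≤ 2 * M * z := by
  have h1 := abs_sub_le_of_abs_deriv_le hv hM x (x + σ * z)
  rw [add_sub_cancel_left, abs_mul, hσ, one_mul, abs_of_pos hz] at h1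
  have h2 : |deriv v x * (σ * z)| ≤ M * z := by
    rw [abs_mul, abs_mul, hσ, one_mul, abs_of_pos hz]
    gcongr; exact hM x
  unfold taylorRem
  exact (abs_sub _ _).trans (by linarith)

/-- The quadratic bound makes the singularity at 0 integrable because `β < 2`; the linear bound
gives decay at infinity because `1 < β`. `domFun` records the better of the two. -/
theorem abs_taylorRem_div_le {v : ℝ → ℝ} {M : ℝ} (hv : ContDiff ℝ 2 v)
    (hM1 : ∀ x, |deriv v x| ≤ M) (hM2 : ∀ x, |deriv (deriv v) x| ≤ M) {σ : ℝ} (hσ : |σ| = 1)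
    (β x : ℝ) {z : ℝ} (hz : 0 < z) :
    |taylorRem σ v x z / z ^ (1 + β)| ≤ 2 * M * domFun (1 - β) (-β) z := by
  have hM0 : 0 ≤ M := (abs_nonneg _).trans (hM1 0)
  have hp : 0 < z ^ (1 + β) := Real.rpow_pos_of_pos hz _
  rw [← min_sq_self_div_rpow hz, abs_div, abs_of_pos hp, mul_div_assoc']
  refine div_le_div_of_nonneg_right ?_ hp.le
  have h1 := abs_taylorRem_le_sq hv hM2 hσ x hz
  have h2 := abs_taylorRem_le (hv.differentiable two_ne_zero) hM1 hσ x hz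
  rcases min_choice (z ^ 2) z with h | h <;> rw [h]
  · nlinarith [sq_nonneg z]
  · exact h2

theorem deriv_eq_zero_of_forall_notMem {g : ℝ → ℝ} {K : Set ℝ} (hK : IsClosed K)
    (hg : ∀ x ∉ K, g x = 0) : ∀ x ∉ K, deriv g x = 0 := by
  intro x hx
  have : g =ᶠ[𝓝 x] fun _ => 0 := by
    filter_upwards [hK.isOpen_compl.mem_nhds hx] with y hy using hg y hy
  rw [this.deriv_eq, deriv_const]

/-- Indicator functions of `K` and of its translate, weighted by `domFun`. -/
noncomputable def shiftDom (β σ : ℝ) (K : Set ℝ) (p : ℝ × ℝ) : ℝ :=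
  (K.indicator 1 p.1 + K.indicator 1 (p.1 + σ * p.2)) * domFun (1 - β) (-β) p.2

/-- If neither `x` nor `x + σ z` lies in `K`, all three terms of the remainder vanish. This
localisation is what makes the bound integrable jointly in `(x, z)`, even against a factor that is
only bounded. -/
theorem abs_taylorRem_div_le_shiftDom {g : ℝ → ℝ} {M : ℝ} (hg : ContDiff ℝ 2 g)
    (hM1 : ∀ x, |deriv g x| ≤ M) (hM2 : ∀ x, |deriv (deriv g) x| ≤ M) {σ : ℝ} (hσ : |σ| = 1)
    {K : Set ℝ} (hK : IsClosed K) (hg0 : ∀ x ∉ K, g x = 0) (β x : ℝ) {z : ℝ} (hz : 0 < z) :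
    |taylorRem σ g x z / z ^ (1 + β)| ≤ 2 * M * shiftDom β σ K (x, z) := by
  have hM0 : 0 ≤ M := (abs_nonneg _).trans (hM1 0)
  have hb := abs_taylorRem_div_le hg hM1 hM2 hσ β x hz
  have hd : 0 ≤ domFun (1 - β) (-β) z := domFun_nonneg hz
  have hi : ∀ y, 0 ≤ K.indicator (1 : ℝ → ℝ) y := fun y => indicator_nonneg (by simp) y
  by_cases h1 : x ∈ K
  · refine hb.trans ?_
    simp only [shiftDom, indicator_of_mem h1, Pi.one_apply]
    have := mul_nonneg (hi (x + σ * z)) hd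
    nlinarith
  by_cases h2 : x + σ * z ∈ K
  · refine hb.trans ?_
    simp only [shiftDom, indicator_of_mem h2, Pi.one_apply]
    have := mul_nonneg (hi x) hd
    nlinarith
  · simp [taylorRem, shiftDom, hg0 _ h1, hg0 _ h2, h1, h2,
      deriv_eq_zero_of_forall_notMem hK hg0 _ h1]

theorem integrable_shiftDom {β : ℝ} (h1 : 1 < β) (h2 : β < 2) (σ : ℝ) {K : Set ℝ}
    (hK : IsCompact K) :
    Integrable (shiftDom β σ K) (volume.prod (volume.restrict (Ioi (0 : ℝ)))) := by
  have hd := integrableOn_dom (a := 1 - β) (b := -β) (by linarith) (by linarith)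
  have hi : Integrable (K.indicator (1 : ℝ → ℝ)) :=
    (integrable_indicator_iff hK.measurableSet).2
      (integrableOn_const (C := (1 : ℝ)) hK.measure_lt_top.ne)
  have hm : Measurable (domFun (1 - β) (-β)) := by unfold domFun; fun_prop
  have hmi : Measurable (K.indicator (1 : ℝ → ℝ)) := measurable_one.indicator hK.measurableSet
  have e : shiftDom β σ K = fun p => K.indicator 1 p.1 * domFun (1 - β) (-β) p.2 +
      K.indicator 1 (p.1 + σ * p.2) * domFun (1 - β) (-β) p.2 := by
    funext p; simp only [shiftDom, add_mul]
  rw [e]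
  refine (hi.mul_prod hd).add ((integrable_prod_iff' ?_).2 ⟨?_, ?_⟩)
  · exact Measurable.aestronglyMeasurable (by fun_prop)
  -- For the translated indicator, `x` is integrated first: the result is the measure of `K`,
  -- whatever `z` is.
  · exact ae_of_all _ fun z => (hi.comp_add_right (σ * z)).mul_const (domFun (1 - β) (-β) z)
  · have : ∀ z, ∫ x, ‖K.indicator (1 : ℝ → ℝ) (x + σ * z) * domFun (1 - β) (-β) z‖ =
        (∫ x, ‖K.indicator (1 : ℝ → ℝ) x‖) * ‖domFun (1 - β) (-β) z‖ := by
      intro z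
      simp only [norm_mul]
      rw [integral_mul_const,
        integral_add_right_eq_self (fun x => ‖K.indicator (1 : ℝ → ℝ) x‖) (σ * z)]
    simp only [this]
    exact hd.norm.const_mul _

/-! ### The adjoint as a singular integral -/

theorem integrableOn_taylorRem_div {v : ℝ → ℝ} {M β : ℝ} (h1 : 1 < β) (h2 : β < 2)
    (hv : ContDiff ℝ 2 v) (hM1 : ∀ x, |deriv v x| ≤ M) (hM2 : ∀ x, |deriv (deriv v) x| ≤ M)
    {σ : ℝ} (hσ : |σ| = 1) (x : ℝ) :
    IntegrableOn (fun z => taylorRem σ v x z / z ^ (1 + β)) (Ioi 0) := by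
  refine ((integrableOn_dom (a := 1 - β) (b := -β) (by linarith) (by linarith)).const_mul
    (2 * M)).mono' ?_ ((ae_restrict_iff' measurableSet_Ioi).2 (ae_of_all _ fun z hz =>
      abs_taylorRem_div_le hv hM1 hM2 hσ β x hz))
  have := hv.continuous.measurable
  unfold taylorRem
  exact Measurable.aestronglyMeasurable (by fun_prop)

theorem exists_abs_deriv_le {g : ℝ → ℝ} (hg : ContDiff ℝ 2 g) (hc : HasCompactSupport g) :
    ∃ M, (∀ x, |g x| ≤ M) ∧ (∀ x, |deriv g x| ≤ M) ∧ ∀ x, |deriv (deriv g) x| ≤ M := by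
  have hg1 : ContDiff ℝ 1 (deriv g) := ((contDiff_succ_iff_deriv (n := 1)).1 hg).2.2
  obtain ⟨A, hA⟩ := hc.exists_bound_of_continuous hg.continuous
  obtain ⟨B, hB⟩ := hc.deriv.exists_bound_of_continuous hg1.continuous
  obtain ⟨C, hC⟩ := hc.deriv.deriv.exists_bound_of_continuous
    (hg1.continuous_deriv le_rfl)
  refine ⟨max A (max B C), fun x => (hA x).trans ?_, fun x => (hB x).trans ?_,
    fun x => (hC x).trans ?_⟩ <;> simp

/-- The dominating function is common to all `y` within distance 1 of `x`, as differentiation under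
the integral requires. Compact support confines `z` to a bounded interval, on which `z ^ (-α)` is
integrable since `α < 1`. -/
theorem integrableOn_comp_div_rpow {h : ℝ → ℝ} (hh : Continuous h) (hc : HasCompactSupport h)
    {α : ℝ} (h1 : α < 1) {σ : ℝ} (hσ : |σ| = 1) (x : ℝ) :
    ∃ b : ℝ → ℝ, IntegrableOn b (Ioi 0) ∧
      ∀ z ∈ Ioi (0 : ℝ), ∀ y ∈ Metric.ball x 1, ‖h (y + σ * z) / z ^ α‖ ≤ b z := by
  obtain ⟨C, hC⟩ := hc.exists_bound_of_continuous hh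
  obtain ⟨R, hR⟩ := hc.isCompact.isBounded.subset_closedBall (0 : ℝ)
  refine ⟨(Ioc 0 (R + |x| + 1)).indicator fun z => C * z ^ (-α), ?_, fun z hz y hy => ?_⟩
  · have := ((intervalIntegral.intervalIntegrable_rpow' (a := 0) (b := R + |x| + 1)
      (r := -α) (by linarith)).1.const_mul C)
    exact ((integrable_indicator_iff measurableSet_Ioc).2 this).integrableOn
  · have hz : 0 < z := hz
    have hC0 : 0 ≤ C := (norm_nonneg _).trans (hC 0)
    by_cases hs : h (y + σ * z) = 0
    · rw [hs, zero_div, norm_zero]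
      exact indicator_nonneg (fun z hz => mul_nonneg hC0 (Real.rpow_nonneg hz.1.le _)) _
    · have hm : y + σ * z ∈ Metric.closedBall 0 R := hR (subset_tsupport _ hs)
      rw [mem_closedBall_zero_iff, Real.norm_eq_abs] at hm
      rw [Metric.mem_ball, Real.dist_eq] at hy
      have hy2 : |y| ≤ |x| + 1 := by
        have := abs_sub_abs_le_abs_sub y x; linarith
      have hz2 : z ≤ R + |x| + 1 := by
        have e : |σ * z| = z := by rw [abs_mul, hσ, one_mul, abs_of_pos hz]
        have e2 : |σ * z| ≤ |y + σ * z| + |y| := by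
          have := abs_sub (y + σ * z) y
          rwa [add_sub_cancel_left] at this
        linarith
      rw [indicator_of_mem (show z ∈ Ioc 0 (R + |x| + 1) from ⟨hz, hz2⟩), norm_div,
        Real.rpow_neg hz.le, div_eq_mul_inv,
        Real.norm_of_nonneg (Real.rpow_nonneg hz.le _)]
      exact mul_le_mul_of_nonneg_right (hC _) (inv_nonneg.2 (Real.rpow_nonneg hz.le _))

theorem integrableOn_comp_div_rpow' {h : ℝ → ℝ} (hh : Continuous h) (hc : HasCompactSupport h)
    {α : ℝ} (h1 : α < 1) {σ : ℝ} (hσ : |σ| = 1) (x : ℝ) :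
    IntegrableOn (fun z => h (x + σ * z) / z ^ α) (Ioi 0) := by
  obtain ⟨b, hb, hbd⟩ := integrableOn_comp_div_rpow hh hc h1 hσ x
  have := hh.measurable
  exact hb.mono' (Measurable.aestronglyMeasurable (by fun_prop))
    ((ae_restrict_iff' measurableSet_Ioi).2 (ae_of_all _ fun z hz =>
      hbd z hz x (Metric.mem_ball_self one_pos)))

theorem hasDerivAt_integral_comp_div_rpow {h : ℝ → ℝ} (hh : ContDiff ℝ 1 h)
    (hc : HasCompactSupport h) {α : ℝ} (h1 : α < 1) {σ : ℝ} (hσ : |σ| = 1) (x : ℝ) :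
    HasDerivAt (fun y => ∫ z in Ioi (0 : ℝ), h (y + σ * z) / z ^ α)
      (∫ z in Ioi (0 : ℝ), deriv h (x + σ * z) / z ^ α) x := by
  have hh' : Continuous (deriv h) := hh.continuous_deriv le_rfl
  obtain ⟨b, hb, hbd⟩ := integrableOn_comp_div_rpow hh' hc.deriv h1 hσ x
  have m1 := hh.continuous.measurable
  have m2 := hh'.measurable
  refine (hasDerivAt_integral_of_dominated_loc_of_deriv_le (μ := volume.restrict (Ioi (0 : ℝ)))
    (F := fun y z => h (y + σ * z) / z ^ α) (F' := fun y z => deriv h (y + σ * z) / z ^ α)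
    (bound := b) (Metric.ball_mem_nhds x one_pos)
    (Eventually.of_forall fun y => Measurable.aestronglyMeasurable (by fun_prop))
    (integrableOn_comp_div_rpow' hh.continuous hc h1 hσ x)
    (Measurable.aestronglyMeasurable (by fun_prop))
    ((ae_restrict_iff' measurableSet_Ioi).2 (ae_of_all _ fun z hz => hbd z hz)) hb
    (ae_of_all _ fun z y _ => ?_)).2
  have := ((hh.differentiable one_ne_zero (y + σ * z)).hasDerivAt.comp_add_const y (σ * z))
  exact this.div_const _

/-- Two integrations by parts in `z` lower the singularity from `z ^ (-(1 + β))` to `z ^ (1 - β)`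
and put both derivatives on `g`. -/
theorem halfLineInt_eq {g : ℝ → ℝ} (hg : ContDiff ℝ 2 g) (hc : HasCompactSupport g)
    {β : ℝ} (h1 : 1 < β) (h2 : β < 2) {σ : ℝ} (hσ : |σ| = 1) (x : ℝ) :
    halfLineInt β σ g x =
      1 / (β * (β - 1)) * ∫ z in Ioi (0 : ℝ), deriv (deriv g) (x + σ * z) / z ^ (β - 1) := by
  obtain ⟨M, -, hM1, hM2⟩ := exists_abs_deriv_le hg hc
  have hM0 : 0 ≤ M := (abs_nonneg _).trans (hM1 0)
  have hg1 : ContDiff ℝ 1 (deriv g) := ((contDiff_succ_iff_deriv (n := 1)).1 hg).2.2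
  have hgd : Differentiable ℝ g := hg.differentiable two_ne_zero
  have hgd' : Differentiable ℝ (deriv g) := hg1.differentiable one_ne_zero
  have hσ2 : σ * σ = 1 := by rw [← abs_mul_abs_self, hσ, one_mul]
  have hb0 : β ≠ 0 := by linarith
  have hb1 : β - 1 ≠ 0 := by linarith
  set c : ℝ := 1 / (β * (β - 1)) with hcdef
  have hc0 : 0 ≤ c := by
    have : 0 < β * (β - 1) := mul_pos (by linarith) (by linarith)
    positivity
  -- `W` collects the boundary terms of both integrations by parts: its derivative is the difference
  -- of the two integrands, so the identity reduces to `W` vanishing at 0 and at infinity.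
  set W : ℝ → ℝ := fun z => -(taylorRem σ g x z * z ^ (-β) * (1 / β)) -
    (deriv g (x + σ * z) - deriv g x) * σ * z ^ (1 - β) * c with hW
  have i1 := integrableOn_taylorRem_div h1 h2 hg hM1 hM2 hσ x
  have i2 := (integrableOn_comp_div_rpow' (hg1.continuous_deriv le_rfl) hc.deriv.deriv
    (α := β - 1) (by linarith) hσ x).const_mul c
  -- Used with `A = M * z` near 0, giving order `z ^ (2 - β)`, and with `A = 2 * M` at infinity,
  -- giving order `z ^ (1 - β)`.
  have bnd : ∀ z, 0 < z → ∀ A, |taylorRem σ g x z| ≤ A * z →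
      |deriv g (x + σ * z) - deriv g x| ≤ A → |W z| ≤ A * (1 / β + c) * z ^ (1 - β) := by
    intro z hz A ha1 ha2
    have e : z * z ^ (-β) = z ^ (1 - β) := by
      nth_rewrite 1 [← Real.rpow_one z]; rw [← Real.rpow_add hz]; congr 1
    have p1 : 0 ≤ z ^ (-β) := Real.rpow_nonneg hz.le _
    have p2 : 0 ≤ z ^ (1 - β) := Real.rpow_nonneg hz.le _
    have p3 : (0 : ℝ) ≤ 1 / β := by
      have : 0 < β := by linarith
      positivity
    have q1 : |-(taylorRem σ g x z * z ^ (-β) * (1 / β))| ≤ A * z ^ (1 - β) * (1 / β) := by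
      rw [abs_neg, abs_mul, abs_mul, abs_of_nonneg p1, abs_of_nonneg p3, ← e, ← mul_assoc]
      gcongr
    have q2 : |(deriv g (x + σ * z) - deriv g x) * σ * z ^ (1 - β) * c| ≤
        A * z ^ (1 - β) * c := by
      rw [abs_mul, abs_mul, abs_mul, hσ, mul_one, abs_of_nonneg p2, abs_of_nonneg hc0]
      gcongr
    refine (abs_sub _ _).trans ((add_le_add q1 q2).trans (le_of_eq ?_))
    ring
  have hW0 : W 0 = 0 := by
    simp [hW, taylorRem]
  have hcont : ContinuousWithinAt W (Ici 0) 0 := by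
    rw [← continuousWithinAt_Ioi_iff_Ici, ContinuousWithinAt, hW0]
    have hlim : Tendsto (fun z : ℝ => M * (1 / β + c) * z ^ (2 - β)) (𝓝[>] 0) (𝓝 0) := by
      have : ContinuousAt (fun z : ℝ => M * (1 / β + c) * z ^ (2 - β)) 0 :=
        (Real.continuousAt_rpow_const _ _ (Or.inr (by linarith))).const_mul _
      have := this.tendsto
      rw [Real.zero_rpow (by linarith), mul_zero] at this
      exact this.mono_left nhdsWithin_le_nhds
    refine squeeze_zero_norm' ?_ hlim
    filter_upwards [self_mem_nhdsWithin] with z hz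
    have hz : 0 < z := hz
    have := bnd z hz (M * z) ((abs_taylorRem_le_sq hg hM2 hσ x hz).trans (by nlinarith)) (by
      have := abs_sub_le_of_abs_deriv_le hgd' hM2 x (x + σ * z)
      rwa [add_sub_cancel_left, abs_mul, hσ, one_mul, abs_of_pos hz] at this)
    refine this.trans (le_of_eq ?_)
    have e : z * z ^ (1 - β) = z ^ (2 - β) := by
      nth_rewrite 1 [← Real.rpow_one z]; rw [← Real.rpow_add hz]; congr 1; ring
    rw [← e]; ring
  have htop : Tendsto W atTop (𝓝 0) := by
    have hlim : Tendsto (fun z : ℝ => 2 * M * (1 / β + c) * z ^ (1 - β)) atTop (𝓝 0) := by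
      have := (tendsto_rpow_neg_atTop (y := β - 1) (by linarith)).const_mul
        (2 * M * (1 / β + c))
      rw [mul_zero, neg_sub] at this
      exact this
    refine squeeze_zero_norm' ?_ hlim
    filter_upwards [eventually_gt_atTop 0] with z hz
    refine bnd z hz (2 * M) (abs_taylorRem_le hgd hM1 hσ x hz) ?_
    refine (abs_sub _ _).trans ?_
    have := hM1 (x + σ * z)
    have := hM1 x
    linarith
  have hder : ∀ z ∈ Ioi (0 : ℝ), HasDerivAt W (taylorRem σ g x z / z ^ (1 + β) -
      c * (deriv (deriv g) (x + σ * z) / z ^ (β - 1))) z := by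
    intro z hz
    have hz : 0 < z := hz
    have l1 : HasDerivAt (fun s : ℝ => x + σ * s) σ z := by
      simpa using ((hasDerivAt_id z).const_mul σ).const_add x
    have d1 : HasDerivAt (taylorRem σ g x) ((deriv g (x + σ * z) - deriv g x) * σ) z := by
      refine ((((hgd _).hasDerivAt.comp z l1).sub_const (g x)).sub
        (((hasDerivAt_id z).const_mul σ).const_mul (deriv g x))).congr_deriv ?_
      ring
    have d2 : HasDerivAt (fun s => (deriv g (x + σ * s) - deriv g x) * σ)
        (deriv (deriv g) (x + σ * z)) z := by
      refine ((((hgd' _).hasDerivAt.comp z l1).sub_const _).mul_const σ).congr_deriv ?_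
      rw [mul_assoc, hσ2, mul_one]
    have p1 := Real.hasDerivAt_rpow_const (x := z) (p := -β) (Or.inl hz.ne')
    have p2 := Real.hasDerivAt_rpow_const (x := z) (p := 1 - β) (Or.inl hz.ne')
    refine ((((d1.mul p1).mul_const (1 / β)).neg).sub ((d2.mul p2).mul_const c)).congr_deriv ?_
    have e1 : z ^ (-β - 1) = (z ^ (1 + β))⁻¹ := by
      rw [← Real.rpow_neg hz.le]; congr 1; ring
    have e2 : z ^ (1 - β) = (z ^ (β - 1))⁻¹ := by
      rw [← Real.rpow_neg hz.le]; congr 1; ring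
    have e3 : 1 - β - 1 = -β := by ring
    rw [e3, e1, e2, hcdef]
    field_simp
    ring
  have key := integral_Ioi_of_hasDerivAt_of_tendsto hcont hder (i1.sub i2) htop
  rw [integral_sub i1 i2, hW0, sub_zero, integral_const_mul, sub_eq_zero] at key
  exact key

theorem setIntegral_Ioi_comp_add_right (f : ℝ → ℝ) (c : ℝ) :
    ∫ z in Ioi (0 : ℝ), f (z + c) = ∫ z in Ioi c, f z := by
  have h := (measurePreserving_add_right volume c).setIntegral_preimage_emb
    (measurableEmbedding_addRight c) f (Ioi c)
  simpa using h

theorem caputoRight_eq (α : ℝ) (g : ℝ → ℝ) (y : ℝ) :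
    caputoRight α g y = dCoef α * ∫ z in Ioi (0 : ℝ), deriv g (y + 1 * z) / z ^ α := by
  unfold caputoRight
  have h := setIntegral_Ioi_comp_add_right (fun z => deriv g z / (z - y) ^ α) y
  rw [← h]
  simp only [add_sub_cancel_right, one_mul, add_comm y]

/-- After the substitution, neither the kernel nor the domain depends on `y`, so a derivative in `y`
falls on `g` alone. -/
theorem caputoLeft_eq (α : ℝ) (g : ℝ → ℝ) (y : ℝ) :
    caputoLeft α g y = dCoef α * ∫ z in Ioi (0 : ℝ), deriv g (y + (-1) * z) / z ^ α := by
  unfold caputoLeft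
  have h := integral_comp_neg_Ioi (-y) (fun z => deriv g z / (y - z) ^ α)
  have h2 := setIntegral_Ioi_comp_add_right (fun z => deriv g (-z) / (y - -z) ^ α) (-y)
  rw [neg_neg] at h
  rw [h] at h2
  rw [← integral_Iic_eq_integral_Iio, ← h2]
  congr 2
  funext z
  congr 2 <;> ring

/-- Differentiating the fractional derivatives under the integral produces the right-hand sides of
`halfLineInt_eq`; the constants agree because `Γ(2 - β) = β (β - 1) Γ(-β)`. Each weight ends up on
the half-line opposite to its own in `rieszFeller`. -/
theorem rieszFellerAdj_eq {g : ℝ → ℝ} (hg : ContDiff ℝ 2 g) (hc : HasCompactSupport g)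
    {β : ℝ} (h1 : 1 < β) (h2 : β < 2) (γ x : ℝ) :
    rieszFellerAdj β γ g x =
      cOne β γ * halfLineInt β (-1) g x + cTwo β γ * halfLineInt β 1 g x := by
  have hg1 : ContDiff ℝ 1 (deriv g) := ((contDiff_succ_iff_deriv (n := 1)).1 hg).2.2
  have d := fun (σ : ℝ) (hσ : |σ| = 1) => (hasDerivAt_integral_comp_div_rpow hg1 hc.deriv
    (α := β - 1) (by linarith) hσ x).const_mul (dCoef (β - 1))
  have hG : dCoef (β - 1) / dCoef (β + 1) = 1 / (β * (β - 1)) := by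
    -- `-β` lies strictly between two integers, so it is not a pole of `Γ` and `Γ(-β)` is nonzero.
    have hn : ∀ m : ℕ, -β ≠ -m := by
      intro m hm
      have hm : β = m := by linarith
      rw [hm] at h1 h2
      have a1 : 1 < m := by exact_mod_cast h1
      have a2 : m < 2 := by exact_mod_cast h2
      omega
    have g0 := Real.Gamma_ne_zero hn
    have ga := Real.Gamma_add_one (s := -β) (by linarith)
    have gb := Real.Gamma_add_one (s := -β + 1) (by linarith)
    have e1 : 1 - (β + 1) = -β := by ring
    have e2 : 1 - (β - 1) = -β + 1 + 1 := by ring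
    have hb1 : β - 1 ≠ 0 := by linarith
    have hb2 : -β + 1 ≠ 0 := by linarith
    have hb0 : β ≠ 0 := by linarith
    rw [dCoef, dCoef, e1, e2, gb, ga]
    field_simp
    ring
  unfold rieszFellerAdj
  simp only [caputoLeft_eq, caputoRight_eq]
  rw [(d (-1) (by simp)).deriv, (d 1 (by simp)).deriv, halfLineInt_eq hg hc h1 h2 (by simp),
    halfLineInt_eq hg hc h1 h2 (by simp), ← hG]
  ring

/-! ### The duality inequality on the line -/

theorem add_deriv_mul_sub_le_of_convexOn {η : ℝ → ℝ} (hη : Differentiable ℝ η)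
    (hc : ConvexOn ℝ univ η) (x y : ℝ) : η x + deriv η x * (y - x) ≤ η y := by
  rcases lt_trichotomy x y with h | h | h
  · have := hc.le_slope_of_hasDerivAt (mem_univ x) (mem_univ y) h (hη x).hasDerivAt
    rw [slope_def_field, le_div_iff₀ (sub_pos.2 h)] at this
    linarith
  · simp [h]
  · have := hc.slope_le_of_hasDerivAt (mem_univ y) (mem_univ x) h (hη x).hasDerivAt
    rw [slope_def_field, div_le_iff₀ (sub_pos.2 h)] at this
    linarith

theorem exists_abs_comp_le {η : ℝ → ℝ} (hη : Continuous η) (M : ℝ) :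
    ∃ C, 0 ≤ C ∧ ∀ w, |w| ≤ M → |η w| ≤ C := by
  obtain ⟨C, hC⟩ := isCompact_Icc (a := -M) (b := M) |>.exists_bound_of_continuousOn
    hη.continuousOn
  exact ⟨max C 0, le_max_right _ _, fun w hw => (hC w (abs_le.1 hw)).trans (le_max_left _ _)⟩

/-- The duality for a single jump length. The tangent inequality for `η` is the only source of
inequality; moving the jump from `v` to `g` is exact. -/
theorem integral_mul_taylorRem_le {η v g : ℝ → ℝ} (hη : ContDiff ℝ 1 η)
    (hηc : ConvexOn ℝ univ η) (hv : ContDiff ℝ 1 v) (hg : ContDiff ℝ 1 g)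
    (hgc : HasCompactSupport g) (hg0 : ∀ x, 0 ≤ g x) (σ z : ℝ) :
    ∫ x, g x * deriv η (v x) * taylorRem σ v x z ≤ ∫ x, η (v x) * taylorRem (-σ) g x z := by
  have cη := hη.continuous
  have cη' := hη.continuous_deriv le_rfl
  have cv := hv.continuous
  have cv' := hv.continuous_deriv le_rfl
  have cg := hg.continuous
  have cg' := hg.continuous_deriv le_rfl
  have hηd := hη.differentiable one_ne_zero
  have hvd := hv.differentiable one_ne_zero
  have hgd := hg.differentiable one_ne_zero
  have i0 : Integrable fun x => g x * η (v (x + σ * z)) :=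
    Continuous.integrable_of_hasCompactSupport (by fun_prop) hgc.mul_right
  have i1 : Integrable fun x => η (v x) * g (x - σ * z) := by
    simpa [mul_comm] using i0.comp_sub_right (σ * z)
  have i2 : Integrable fun x => g x * η (v x) :=
    Continuous.integrable_of_hasCompactSupport (by fun_prop) hgc.mul_right
  have i3 : Integrable fun x => deriv g x * η (v x) :=
    Continuous.integrable_of_hasCompactSupport (by fun_prop) hgc.deriv.mul_right
  have i4 : Integrable fun x => g x * (deriv η (v x) * deriv v x) :=
    Continuous.integrable_of_hasCompactSupport (by fun_prop) hgc.mul_right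
  have i5 : Integrable fun x => g x * deriv η (v x) * taylorRem σ v x z := by
    refine Continuous.integrable_of_hasCompactSupport ?_ hgc.mul_right.mul_right
    unfold taylorRem; fun_prop
  have er : (fun x => η (v x) * taylorRem (-σ) g x z) = fun x =>
      η (v x) * g (x - σ * z) - g x * η (v x) + deriv g x * η (v x) * (σ * z) := by
    funext x
    have : x + -σ * z = x - σ * z := by ring
    rw [taylorRem, this]; ring
  have i6 : Integrable fun x => η (v x) * taylorRem (-σ) g x z := by
    rw [er]; exact (i1.sub i2).add (i3.mul_const _)
  have t : ∫ x, g x * η (v (x + σ * z)) = ∫ x, η (v x) * g (x - σ * z) := by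
    rw [← integral_sub_right_eq_self _ (σ * z)]
    simp [mul_comm]
  have d0 : ∫ x, (deriv g x * η (v x) + g x * (deriv η (v x) * deriv v x)) = 0 :=
    integral_eq_zero_of_hasDerivAt_of_integrable (fun x =>
      (hgd x).hasDerivAt.mul ((hηd _).hasDerivAt.comp x (hvd x).hasDerivAt)) (i3.add i4) i2
  -- The two correction terms have zero integral: one compares a function with its translate (`t`),
  -- the other is a multiple of the derivative of `g * η ∘ v` (`d0`).
  have hle : ∀ x, g x * deriv η (v x) * taylorRem σ v x z ≤
      η (v x) * taylorRem (-σ) g x z +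
      (g x * η (v (x + σ * z)) - η (v x) * g (x - σ * z)) -
      (deriv g x * η (v x) + g x * (deriv η (v x) * deriv v x)) * (σ * z) := by
    intro x
    have h := mul_le_mul_of_nonneg_left
      (add_deriv_mul_sub_le_of_convexOn hηd hηc (v x) (v (x + σ * z))) (hg0 x)
    rw [congrFun er x, taylorRem]
    linarith
  have j1 : Integrable fun x => g x * η (v (x + σ * z)) - η (v x) * g (x - σ * z) := i0.sub i1
  have j2 : Integrable fun x => η (v x) * taylorRem (-σ) g x z +
      (g x * η (v (x + σ * z)) - η (v x) * g (x - σ * z)) := i6.add j1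
  have j3 : Integrable fun x =>
      (deriv g x * η (v x) + g x * (deriv η (v x) * deriv v x)) * (σ * z) :=
    (i3.add i4).mul_const _
  refine (integral_mono i5 (j2.sub j3) hle).trans (le_of_eq ?_)
  simp only [Pi.sub_apply]
  rw [integral_sub j2 j3, integral_add i6 j1, integral_sub i0 i1, t, integral_mul_const, d0]
  ring

theorem ae_prod_snd_pos :
    ∀ᵐ p : ℝ × ℝ ∂(volume.prod (volume.restrict (Ioi (0 : ℝ)))), p.2 ∈ Ioi (0 : ℝ) :=
  Measure.quasiMeasurePreserving_snd.ae (ae_restrict_mem measurableSet_Ioi)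

/-- Fubini puts the `z` integral outside, where `integral_mul_taylorRem_le` applies for each `z`. On
the left, `g` supplies integrability in `x`. On the right, `η ∘ v` is only bounded, so integrability
comes from `shiftDom`. -/
theorem integral_mul_halfLineInt_le {η v g : ℝ → ℝ} {M β : ℝ} (h1 : 1 < β) (h2 : β < 2)
    (hη : ContDiff ℝ 1 η) (hηc : ConvexOn ℝ univ η) (hv : ContDiff ℝ 2 v)
    (hM0 : ∀ x, |v x| ≤ M) (hM1 : ∀ x, |deriv v x| ≤ M) (hM2 : ∀ x, |deriv (deriv v) x| ≤ M)
    (hg : ContDiff ℝ 2 g) (hgc : HasCompactSupport g) (hg0 : ∀ x, 0 ≤ g x)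
    {σ : ℝ} (hσ : |σ| = 1) :
    Integrable (fun x => g x * deriv η (v x) * halfLineInt β σ v x) ∧
    Integrable (fun x => η (v x) * halfLineInt β (-σ) g x) ∧
    ∫ x, g x * deriv η (v x) * halfLineInt β σ v x ≤
      ∫ x, η (v x) * halfLineInt β (-σ) g x := by
  have cη := hη.continuous
  have cη' := hη.continuous_deriv le_rfl
  have cv := hv.continuous
  have cg := hg.continuous
  have hσ' : |-σ| = 1 := by rwa [abs_neg]
  have ia : Integrable fun x => g x * deriv η (v x) :=
    Continuous.integrable_of_hasCompactSupport (by fun_prop) hgc.mul_right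
  have hd := integrableOn_dom (a := 1 - β) (b := -β) (by linarith) (by linarith)
  have hp : Measurable fun p : ℝ × ℝ => p.2 ^ (1 + β) := by fun_prop
  have mv : Measurable fun p : ℝ × ℝ => taylorRem σ v p.1 p.2 := by
    have := cv.measurable
    unfold taylorRem; fun_prop
  have mg : Measurable fun p : ℝ × ℝ => taylorRem (-σ) g p.1 p.2 := by
    have := cg.measurable
    unfold taylorRem; fun_prop
  have mη := cη.measurable
  have mη' := cη'.measurable
  have mvv := cv.measurable
  have mgg := cg.measurable
  have iA : Integrable (fun p : ℝ × ℝ =>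
      g p.1 * deriv η (v p.1) * (taylorRem σ v p.1 p.2 / p.2 ^ (1 + β)))
      (volume.prod (volume.restrict (Ioi (0 : ℝ)))) := by
    refine (ia.norm.mul_prod (hd.const_mul (2 * M))).mono'
      (Measurable.aestronglyMeasurable (by fun_prop)) ?_
    filter_upwards [ae_prod_snd_pos] with p hp
    rw [norm_mul]
    exact mul_le_mul_of_nonneg_left (abs_taylorRem_div_le hv hM1 hM2 hσ β p.1 hp) (norm_nonneg _)
  obtain ⟨C, hC0, hC⟩ := exists_abs_comp_le cη M
  obtain ⟨N, -, hN1, hN2⟩ := exists_abs_deriv_le hg hgc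
  have iB : Integrable (fun p : ℝ × ℝ =>
      η (v p.1) * (taylorRem (-σ) g p.1 p.2 / p.2 ^ (1 + β)))
      (volume.prod (volume.restrict (Ioi (0 : ℝ)))) := by
    refine ((integrable_shiftDom h1 h2 (-σ) hgc.isCompact).const_mul (C * (2 * N))).mono'
      (Measurable.aestronglyMeasurable (by fun_prop)) ?_
    filter_upwards [ae_prod_snd_pos] with p hp
    rw [norm_mul, mul_assoc]
    exact mul_le_mul (hC _ (hM0 _)) (abs_taylorRem_div_le_shiftDom hg hN1 hN2 hσ'
      (isClosed_tsupport g) (fun x hx => image_eq_zero_of_notMem_tsupport hx) β p.1 hp)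
      (norm_nonneg _) hC0
  have kA := iA.integral_prod_left
  have kB := iB.integral_prod_left
  simp only [integral_const_mul] at kA kB
  refine ⟨kA, kB, ?_⟩
  unfold halfLineInt
  simp only [← integral_const_mul]
  rw [integral_integral_swap (f := fun x z =>
      g x * deriv η (v x) * (taylorRem σ v x z / z ^ (1 + β))) iA,
    integral_integral_swap (f := fun x z =>
      η (v x) * (taylorRem (-σ) g x z / z ^ (1 + β))) iB]
  refine setIntegral_mono_on iA.integral_prod_right iB.integral_prod_right measurableSet_Ioi
    fun z hz => ?_
  have hz : 0 < z := hz
  simp only [mul_div_assoc']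
  rw [integral_div, integral_div]
  exact div_le_div_of_nonneg_right (integral_mul_taylorRem_le hη hηc
    (hv.of_le (by norm_num)) (hg.of_le (by norm_num)) hgc hg0 σ z)
    (Real.rpow_nonneg hz.le _)

/-- The bounds `γ ≤ β` and `-γ ≤ 2 - β` place the angle in `[0, π]`. -/
theorem cOne_nonneg {β γ : ℝ} (h1 : 1 < β) (hγ : |γ| ≤ min β (2 - β)) : 0 ≤ cOne β γ := by
  obtain ⟨ha, hb⟩ := le_min_iff.1 hγ
  have ha := abs_le.1 ha
  have hb := abs_le.1 hb
  have hG : 0 < Real.Gamma (1 + β) := Real.Gamma_pos_of_pos (by linarith)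
  have hs : 0 ≤ Real.sin ((β - γ) * Real.pi / 2) :=
    Real.sin_nonneg_of_nonneg_of_le_pi
      (by have := Real.pi_pos; have : 0 ≤ β - γ := by linarith
          positivity)
      (by have := Real.pi_pos; nlinarith)
  unfold cOne
  have := Real.pi_pos
  positivity

theorem cTwo_nonneg {β γ : ℝ} (h1 : 1 < β) (hγ : |γ| ≤ min β (2 - β)) : 0 ≤ cTwo β γ := by
  have h := cOne_nonneg (γ := -γ) h1 (by rwa [abs_neg])
  unfold cOne at h
  rwa [sub_neg_eq_add] at h

theorem integral_mul_rieszFeller_le {η v g : ℝ → ℝ} {M β γ : ℝ} (h1 : 1 < β) (h2 : β < 2)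
    (hγ : |γ| ≤ min β (2 - β))
    (hη : ContDiff ℝ 1 η) (hηc : ConvexOn ℝ univ η) (hv : ContDiff ℝ 2 v)
    (hM0 : ∀ x, |v x| ≤ M) (hM1 : ∀ x, |deriv v x| ≤ M) (hM2 : ∀ x, |deriv (deriv v) x| ≤ M)
    (hg : ContDiff ℝ 2 g) (hgc : HasCompactSupport g) (hg0 : ∀ x, 0 ≤ g x) :
    0 ≤ ∫ x, (η (v x) * rieszFellerAdj β γ g x - g x * deriv η (v x) * rieszFeller β γ v x) := by
  obtain ⟨a1, b1, c1⟩ := integral_mul_halfLineInt_le h1 h2 hη hηc hv hM0 hM1 hM2 hg hgc hg0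
    (σ := 1) (by simp)
  obtain ⟨a2, b2, c2⟩ := integral_mul_halfLineInt_le h1 h2 hη hηc hv hM0 hM1 hM2 hg hgc hg0
    (σ := -1) (by simp)
  rw [neg_neg] at b2 c2
  have e : ∀ x, η (v x) * rieszFellerAdj β γ g x -
      g x * deriv η (v x) * rieszFeller β γ v x =
      cOne β γ * (η (v x) * halfLineInt β (-1) g x - g x * deriv η (v x) * halfLineInt β 1 v x) +
      cTwo β γ *
        (η (v x) * halfLineInt β 1 g x - g x * deriv η (v x) * halfLineInt β (-1) v x) := by
    intro x
    rw [rieszFellerAdj_eq hg hgc h1 h2, rieszFeller_eq_halfLineInt]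
    ring
  have d1 : Integrable fun x => η (v x) * halfLineInt β (-1) g x -
      g x * deriv η (v x) * halfLineInt β 1 v x := b1.sub a1
  have d2 : Integrable fun x => η (v x) * halfLineInt β 1 g x -
      g x * deriv η (v x) * halfLineInt β (-1) v x := b2.sub a2
  simp only [e]
  rw [integral_add (d1.const_mul _) (d2.const_mul _), integral_const_mul,
    integral_const_mul, integral_sub b1 a1, integral_sub b2 a2]
  exact add_nonneg (mul_nonneg (cOne_nonneg h1 hγ) (sub_nonneg.2 c1))
    (mul_nonneg (cTwo_nonneg h1 hγ) (sub_nonneg.2 c2))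

/-! ### Slices of functions of two variables -/

theorem hasDerivAt_slice_snd {F : ℝ × ℝ → ℝ} {t x : ℝ} (hF : DifferentiableAt ℝ F (t, x)) :
    HasDerivAt (fun y => F (t, y)) (fderiv ℝ F (t, x) (0, 1)) x :=
  hF.hasFDerivAt.comp_hasDerivAt x ((hasDerivAt_const x t).prodMk (hasDerivAt_id x))

theorem hasDerivAt_slice_fst {F : ℝ × ℝ → ℝ} {t x : ℝ} (hF : DifferentiableAt ℝ F (t, x)) :
    HasDerivAt (fun s => F (s, x)) (fderiv ℝ F (t, x) (1, 0)) t :=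
  hF.hasFDerivAt.comp_hasDerivAt t ((hasDerivAt_id t).prodMk (hasDerivAt_const t x))

theorem deriv_deriv_slice_snd {F : ℝ × ℝ → ℝ} {t : ℝ} (hF : ∀ y, ContDiffAt ℝ 2 F (t, y))
    (x : ℝ) : deriv (deriv fun y => F (t, y)) x = fderiv ℝ (fderiv ℝ F) (t, x) (0, 1) (0, 1) := by
  have e : (deriv fun y => F (t, y)) = fun y => fderiv ℝ F (t, y) (0, 1) := by
    funext y
    exact (hasDerivAt_slice_snd ((hF y).differentiableAt two_ne_zero)).deriv
  have h : DifferentiableAt ℝ (fderiv ℝ F) (t, x) :=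
    ((hF x).fderiv_right (m := 1) (by norm_num)).differentiableAt one_ne_zero
  have h2 := h.hasFDerivAt.comp_hasDerivAt x ((hasDerivAt_const x t).prodMk (hasDerivAt_id x))
  rw [e]
  exact (h2.clm_apply (hasDerivAt_const x ((0, 1) : ℝ × ℝ))).deriv.trans (by simp)

theorem contDiff_slice_snd {F : ℝ × ℝ → ℝ} {t : ℝ} {n : WithTop ℕ∞}
    (hF : ∀ y, ContDiffAt ℝ n F (t, y)) : ContDiff ℝ n fun y => F (t, y) :=
  contDiff_iff_contDiffAt.2 fun y => (hF y).comp y (contDiffAt_const.prodMk contDiffAt_id)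

theorem abs_clm_apply_le {L : ℝ × ℝ →L[ℝ] ℝ} {C : ℝ} (hL : ‖L‖ ≤ C) : |L (0, 1)| ≤ C := by
  have := L.le_opNorm (0, 1)
  have e : ‖((0 : ℝ), (1 : ℝ))‖ = 1 := by simp [Prod.norm_def]
  rw [e, mul_one] at this
  exact this.trans hL

theorem abs_clm_apply_apply_le {L : ℝ × ℝ →L[ℝ] ℝ × ℝ →L[ℝ] ℝ} {C : ℝ} (hL : ‖L‖ ≤ C) :
    |L (0, 1) (0, 1)| ≤ C := by
  refine abs_clm_apply_le ?_
  have := L.le_opNorm (0, 1)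
  have e : ‖((0 : ℝ), (1 : ℝ))‖ = 1 := by simp [Prod.norm_def]
  rw [e, mul_one] at this
  exact this.trans hL

theorem IsCbTwo.contDiffAt {u : ℝ → ℝ → ℝ} (hu : IsCbTwo u) {t : ℝ} (ht : 0 < t) (x : ℝ) :
    ContDiffAt ℝ 2 (Function.uncurry u) (t, x) :=
  hu.contDiffOn.contDiffAt ((isOpen_Ioi.prod isOpen_univ).mem_nhds ⟨ht, mem_univ x⟩)

/-- The derivatives of a slice are Fréchet derivatives evaluated at `(0, 1)`, a vector of norm 1, so
one constant serves all times. -/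
theorem IsCbTwo.exists_bound {u : ℝ → ℝ → ℝ} (hu : IsCbTwo u) :
    ∃ M, ∀ t, 0 < t → ∀ x, |u t x| ≤ M ∧ |deriv (u t) x| ≤ M ∧ |deriv (deriv (u t)) x| ≤ M := by
  obtain ⟨A, hA⟩ := hu.bounded 0 (by norm_num)
  obtain ⟨B, hB⟩ := hu.bounded 1 (by norm_num)
  obtain ⟨C, hC⟩ := hu.bounded 2 (by norm_num)
  refine ⟨max A (max B C), fun t ht x => ⟨?_, ?_, ?_⟩⟩
  · have := hA (t, x) ⟨ht, mem_univ x⟩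
    rw [norm_iteratedFDeriv_zero] at this
    exact le_max_of_le_left this
  · have := hB (t, x) ⟨ht, mem_univ x⟩
    rw [norm_iteratedFDeriv_one] at this
    have e := (hasDerivAt_slice_snd ((hu.contDiffAt ht x).differentiableAt two_ne_zero)).deriv
    change deriv (u t) x = _ at e
    rw [e]
    exact le_max_of_le_right (le_max_of_le_left (abs_clm_apply_le this))
  · have := hC (t, x) ⟨ht, mem_univ x⟩
    rw [← norm_iteratedFDeriv_fderiv, norm_iteratedFDeriv_one] at this
    have e := deriv_deriv_slice_snd (fun y => hu.contDiffAt ht y) x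
    change deriv (deriv (u t)) x = _ at e
    rw [e]
    exact le_max_of_le_right (le_max_of_le_right (abs_clm_apply_apply_le this))

/-! ### Integrability of the adjoint in both variables -/

theorem hasCompactSupport_slice_snd {F : ℝ × ℝ → ℝ} (hc : HasCompactSupport F) (t : ℝ) :
    HasCompactSupport fun y => F (t, y) := by
  refine HasCompactSupport.intro (hc.isCompact.image continuous_snd) fun y hy => ?_
  by_contra h
  exact hy ⟨(t, y), subset_tsupport _ h, rfl⟩

theorem contDiff_fderiv_apply {F : ℝ × ℝ → ℝ} {n : ℕ} (hF : ContDiff ℝ (n + 1) F) (v : ℝ × ℝ) :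
    ContDiff ℝ n fun p => fderiv ℝ F p v :=
  (hF.fderiv_right le_rfl).clm_apply contDiff_const

theorem exists_abs_fderiv_apply_le {F : ℝ × ℝ → ℝ} (hF : ContDiff ℝ 1 F)
    (hFc : HasCompactSupport F) (v : ℝ × ℝ) : ∃ A, ∀ p, |fderiv ℝ F p v| ≤ A :=
  (hFc.fderiv_apply ℝ v).exists_bound_of_continuous
    (contDiff_fderiv_apply (n := 0) (by simpa using hF) v).continuous

theorem exists_abs_deriv_slice_le {F : ℝ × ℝ → ℝ} (hF : ContDiff ℝ 2 F)
    (hFc : HasCompactSupport F) :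
    ∃ M, (∀ t y, |deriv (fun y => F (t, y)) y| ≤ M) ∧
      ∀ t y, |deriv (deriv (fun y => F (t, y))) y| ≤ M := by
  have hG : ContDiff ℝ 1 fun p => fderiv ℝ F p (0, 1) :=
    contDiff_fderiv_apply (n := 1) (by exact_mod_cast hF) (0, 1)
  obtain ⟨A, hA⟩ := exists_abs_fderiv_apply_le (hF.of_le one_le_two) hFc (0, 1)
  obtain ⟨B, hB⟩ := exists_abs_fderiv_apply_le hG (hFc.fderiv_apply ℝ (0, 1)) (0, 1)
  have hd : ∀ t, (deriv fun y => F (t, y)) = fun y => fderiv ℝ F (t, y) (0, 1) := fun t =>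
    funext fun y => (hasDerivAt_slice_snd (hF.differentiable two_ne_zero (t, y))).deriv
  refine ⟨max A B, fun t y => ?_, fun t y => ?_⟩
  · rw [hd]
    exact le_max_of_le_left (hA _)
  · rw [hd, (hasDerivAt_slice_snd (hG.differentiable one_ne_zero (t, y))).deriv]
    exact le_max_of_le_right (hB _)

theorem stronglyMeasurable_halfLineInt_slice {F : ℝ × ℝ → ℝ} (hF : ContDiff ℝ 2 F) (β σ : ℝ) :
    StronglyMeasurable fun p : ℝ × ℝ => halfLineInt β σ (fun y => F (p.1, y)) p.2 := by
  have hF1 : ContDiff ℝ 1 (fderiv ℝ F) := hF.fderiv_right (by norm_num)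
  have hd : ∀ t y, deriv (fun y => F (t, y)) y = fderiv ℝ F (t, y) (0, 1) := fun t y =>
    (hasDerivAt_slice_snd (hF.differentiable two_ne_zero (t, y))).deriv
  -- Replacing the slice derivative by `fderiv` makes the joint measurability in `(t, x, z)`
  -- visible.
  simp only [halfLineInt, taylorRem, hd]
  refine StronglyMeasurable.integral_prod_right (f := fun (p : ℝ × ℝ) (z : ℝ) =>
    (F (p.1, p.2 + σ * z) - F (p.1, p.2) - fderiv ℝ F (p.1, p.2) (0, 1) * (σ * z)) /
      z ^ (1 + β)) (Measurable.stronglyMeasurable ?_)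
  have m1 := hF.continuous.measurable
  have m2 : Measurable fun p : ℝ × ℝ => fderiv ℝ F p (0, 1) :=
    (hF1.continuous.clm_apply continuous_const).measurable
  have n1 : Measurable fun q : (ℝ × ℝ) × ℝ => F (q.1.1, q.1.2 + σ * q.2) := m1.comp (by fun_prop)
  have n2 : Measurable fun q : (ℝ × ℝ) × ℝ => F (q.1.1, q.1.2) := m1.comp (by fun_prop)
  have n3 : Measurable fun q : (ℝ × ℝ) × ℝ => fderiv ℝ F (q.1.1, q.1.2) (0, 1) :=
    m2.comp (by fun_prop)
  exact ((n1.sub n2).sub (n3.mul (by fun_prop))).div (by fun_prop)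

theorem abs_halfLineInt_le {g : ℝ → ℝ} {M : ℝ} (hg : ContDiff ℝ 2 g)
    (hM1 : ∀ x, |deriv g x| ≤ M) (hM2 : ∀ x, |deriv (deriv g) x| ≤ M) {σ : ℝ} (hσ : |σ| = 1)
    {K : Set ℝ} (hK : IsClosed K) (hg0 : ∀ x ∉ K, g x = 0) (β x : ℝ)
    (hi : IntegrableOn (fun z => shiftDom β σ K (x, z)) (Ioi 0)) :
    |halfLineInt β σ g x| ≤ 2 * M * ∫ z in Ioi (0 : ℝ), shiftDom β σ K (x, z) := by
  rw [← integral_const_mul]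
  refine norm_integral_le_of_norm_le (f := fun z => taylorRem σ g x z / z ^ (1 + β))
    (hi.const_mul (2 * M)) ?_
  exact (ae_restrict_iff' measurableSet_Ioi).2 (ae_of_all _ fun z hz =>
    abs_taylorRem_div_le_shiftDom hg hM1 hM2 hσ hK hg0 β x hz)

/-- The singular integral is not compactly supported in `x`. It is dominated by the product of the
indicator of the time projection of the support and the `z` integral of `shiftDom` for the space
projection. -/
theorem integrable_halfLineInt_slice {F : ℝ × ℝ → ℝ} (hF : ContDiff ℝ 2 F)
    (hFc : HasCompactSupport F) {β : ℝ} (h1 : 1 < β) (h2 : β < 2)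
    {σ : ℝ} (hσ : |σ| = 1) :
    Integrable fun p : ℝ × ℝ => halfLineInt β σ (fun y => F (p.1, y)) p.2 := by
  obtain ⟨M, hM1, hM2⟩ := exists_abs_deriv_slice_le hF hFc
  obtain ⟨K1, hK1, hz1⟩ : ∃ K, IsCompact K ∧ ∀ t ∉ K, ∀ x, F (t, x) = 0 :=
    ⟨_, hFc.isCompact.image continuous_fst, fun t ht x => by
      by_contra h
      exact ht ⟨(t, x), subset_tsupport F h, rfl⟩⟩
  obtain ⟨K2, hK2, hz2⟩ : ∃ K, IsCompact K ∧ ∀ t, ∀ x ∉ K, F (t, x) = 0 :=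
    ⟨_, hFc.isCompact.image continuous_snd, fun t x hx => by
      by_contra h
      exact hx ⟨(t, x), subset_tsupport F h, rfl⟩⟩
  have hi : Integrable (K1.indicator (1 : ℝ → ℝ)) :=
    (integrable_indicator_iff hK1.measurableSet).2
      (integrableOn_const (C := (1 : ℝ)) hK1.measure_lt_top.ne)
  have hs := integrable_shiftDom h1 h2 σ hK2
  refine (hi.mul_prod (hs.integral_prod_left.const_mul (2 * M))).mono'
    (stronglyMeasurable_halfLineInt_slice hF β σ).aestronglyMeasurable ?_
  have hsx : ∀ᵐ p : ℝ × ℝ, Integrable (fun z => shiftDom β σ K2 (p.2, z))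
      (volume.restrict (Ioi 0)) :=
    Measure.quasiMeasurePreserving_snd.ae hs.prod_right_ae
  filter_upwards [hsx] with p hp
  by_cases ht : p.1 ∈ K1
  · rw [indicator_of_mem ht, Pi.one_apply, one_mul]
    exact abs_halfLineInt_le (contDiff_slice_snd fun y => hF.contDiffAt)
      (hM1 _) (hM2 _) hσ hK2.isClosed (hz2 _) β p.2 hp
  · simp [indicator_of_notMem ht, halfLineInt, taylorRem, hz1 _ ht]

theorem integrable_rieszFellerAdj_slice {φ : ℝ → ℝ → ℝ}
    (hφ : ContDiff ℝ 2 (Function.uncurry φ)) (hφc : HasCompactSupport (Function.uncurry φ))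
    {β : ℝ} (h1 : 1 < β) (h2 : β < 2) (γ : ℝ) :
    Integrable fun p : ℝ × ℝ => rieszFellerAdj β γ (φ p.1) p.2 := by
  have e : (fun p : ℝ × ℝ => rieszFellerAdj β γ (φ p.1) p.2) = fun p : ℝ × ℝ =>
      cOne β γ * halfLineInt β (-1) (φ p.1) p.2 + cTwo β γ * halfLineInt β 1 (φ p.1) p.2 := by
    funext p
    exact rieszFellerAdj_eq (contDiff_slice_snd fun y => hφ.contDiffAt)
      (hasCompactSupport_slice_snd hφc p.1) h1 h2 γ p.2
  rw [e]
  exact ((integrable_halfLineInt_slice hφ hφc h1 h2 (by simp)).const_mul _).add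
    ((integrable_halfLineInt_slice hφ hφc h1 h2 (by simp)).const_mul _)

/-! ### The entropy flux -/

theorem hasDerivAt_primitive {h : ℝ → ℝ} (hh : Continuous h) (w : ℝ) :
    HasDerivAt (fun w => ∫ z in (0 : ℝ)..w, h z) (h w) w :=
  intervalIntegral.integral_hasDerivAt_right (hh.intervalIntegrable _ _)
    (hh.stronglyMeasurableAtFilter _ _) hh.continuousAt

theorem contDiff_primitive {h : ℝ → ℝ} (hh : Continuous h) :
    ContDiff ℝ 1 fun w => ∫ z in (0 : ℝ)..w, h z := by
  refine contDiff_one_iff_deriv.2 ⟨fun w => (hasDerivAt_primitive hh w).differentiableAt, ?_⟩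
  rwa [show deriv (fun w => ∫ z in (0 : ℝ)..w, h z) = h from
    funext fun w => (hasDerivAt_primitive hh w).deriv]

theorem continuous_entropyFlux {f η : ℝ → ℝ} (hf : ContDiff ℝ 2 f) (hη : Continuous η) :
    Continuous (entropyFlux f η) := by
  have hf1 : ContDiff ℝ 1 (deriv f) := ((contDiff_succ_iff_deriv (n := 1)).1 hf).2.2
  have c1 := hf1.continuous
  have c2 := hf1.continuous_deriv le_rfl
  have := (contDiff_primitive (c2.mul hη)).continuous
  unfold entropyFlux
  exact ((c1.mul hη).sub continuous_const).sub this

theorem contDiff_entropyFlux {f η : ℝ → ℝ} (hf : ContDiff ℝ 2 f) (hη : ContDiff ℝ 1 η) :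
    ContDiff ℝ 1 (entropyFlux f η) := by
  have hf1 : ContDiff ℝ 1 (deriv f) := ((contDiff_succ_iff_deriv (n := 1)).1 hf).2.2
  have := contDiff_primitive ((hf1.continuous_deriv le_rfl).mul hη.continuous)
  exact ((hf1.mul hη).sub contDiff_const).sub this

/-- The terms `f'' η` cancel, leaving the classical compatibility `q' = f' η'`. -/
theorem hasDerivAt_entropyFlux {f η : ℝ → ℝ} (hf : ContDiff ℝ 2 f) (hη : ContDiff ℝ 1 η)
    (w : ℝ) : HasDerivAt (entropyFlux f η) (deriv f w * deriv η w) w := by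
  have hf1 : ContDiff ℝ 1 (deriv f) := ((contDiff_succ_iff_deriv (n := 1)).1 hf).2.2
  have h3 := hasDerivAt_primitive ((hf1.continuous_deriv le_rfl).mul hη.continuous) w
  refine (((((hf1.differentiable one_ne_zero w).hasDerivAt.mul
    (hη.differentiable one_ne_zero w).hasDerivAt)).sub_const (deriv f 0 * η 0)).sub
      h3).congr_deriv ?_
  simp

/-- The flux is linear in its entropy and contains no derivative of it. The constant is chosen
before the entropies, so it stays fixed along an approximating sequence. -/
theorem exists_abs_entropyFlux_sub_le {f : ℝ → ℝ} (hf : ContDiff ℝ 2 f) (M : ℝ) :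
    ∃ C, 0 ≤ C ∧ ∀ η₁ η₂ : ℝ → ℝ, Continuous η₁ → Continuous η₂ → ∀ ε,
      (∀ w, |w| ≤ M → |η₁ w - η₂ w| ≤ ε) →
      ∀ w, |w| ≤ M → |entropyFlux f η₁ w - entropyFlux f η₂ w| ≤ C * ε := by
  have hf1 : ContDiff ℝ 1 (deriv f) := ((contDiff_succ_iff_deriv (n := 1)).1 hf).2.2
  have c2 := hf1.continuous_deriv le_rfl
  obtain ⟨A, hA0, hA⟩ := exists_abs_comp_le hf1.continuous M
  obtain ⟨B, hB0, hB⟩ := exists_abs_comp_le c2 M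
  -- One `A` for each boundary term, and `B * |M|` for the integral over an interval of length at
  -- most `M`; the absolute value keeps the constant nonnegative for every `M`.
  refine ⟨A + A + B * |M|, by positivity, fun η₁ η₂ h1 h2 ε hε w hw => ?_⟩
  have hM : (0 : ℝ) ≤ M := (abs_nonneg w).trans hw
  have hM0 : |(0 : ℝ)| ≤ M := by simpa
  have hε0 : 0 ≤ ε := (abs_nonneg _).trans (hε 0 hM0)
  have e : entropyFlux f η₁ w - entropyFlux f η₂ w = deriv f w * (η₁ w - η₂ w) -
      deriv f 0 * (η₁ 0 - η₂ 0) - ∫ z in (0 : ℝ)..w, deriv (deriv f) z * (η₁ z - η₂ z) := by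
    have i1 : IntervalIntegrable (fun z => deriv (deriv f) z * η₁ z) volume 0 w :=
      (c2.mul h1).intervalIntegrable _ _
    have i2 : IntervalIntegrable (fun z => deriv (deriv f) z * η₂ z) volume 0 w :=
      (c2.mul h2).intervalIntegrable _ _
    simp only [mul_sub]
    rw [intervalIntegral.integral_sub i1 i2]
    unfold entropyFlux
    ring
  have b1 : |deriv f w * (η₁ w - η₂ w)| ≤ A * ε := by
    rw [abs_mul]; exact mul_le_mul (hA w hw) (hε w hw) (abs_nonneg _) hA0
  have b2 : |deriv f 0 * (η₁ 0 - η₂ 0)| ≤ A * ε := by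
    rw [abs_mul]; exact mul_le_mul (hA 0 hM0) (hε 0 hM0) (abs_nonneg _) hA0
  have b3 : ‖∫ z in (0 : ℝ)..w, deriv (deriv f) z * (η₁ z - η₂ z)‖ ≤ B * ε * |w - 0| := by
    refine intervalIntegral.norm_integral_le_of_norm_le_const fun z hz => ?_
    have hz' : |z| ≤ M := by
      have := uIoc_subset_uIcc hz
      have h := abs_sub_left_of_mem_uIcc this
      rw [sub_zero, sub_zero] at h
      exact h.trans hw
    rw [norm_mul]
    exact mul_le_mul (hB z hz') (hε z hz') (abs_nonneg _) hB0
  rw [sub_zero, Real.norm_eq_abs] at b3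
  have b4 : B * ε * |w| ≤ B * ε * |M| := by
    rw [abs_of_nonneg hM]; gcongr
  rw [e]
  calc _ ≤ |deriv f w * (η₁ w - η₂ w)| + |deriv f 0 * (η₁ 0 - η₂ 0)| +
        |∫ z in (0 : ℝ)..w, deriv (deriv f) z * (η₁ z - η₂ z)| :=
        (abs_sub _ _).trans (by gcongr; exact abs_sub _ _)
    _ ≤ _ := by linarith

/-! ### Smoothing a convex function by averaging -/

/-- A moving average over `[w, w + δ]` suffices: it is a difference quotient of a primitive of `η`,
hence C¹, and an average of translates of `η`, hence convex. -/
theorem exists_contDiff_convexOn_approx {η : ℝ → ℝ} (hη : Continuous η)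
    (hc : ConvexOn ℝ univ η) (M : ℝ) {ε : ℝ} (hε : 0 < ε) :
    ∃ θ : ℝ → ℝ, ContDiff ℝ 1 θ ∧ ConvexOn ℝ univ θ ∧ ∀ w, |w| ≤ M → |θ w - η w| ≤ ε := by
  -- The margin 1 leaves room for the shift, since `δ ≤ 1`.
  have huc := (isCompact_Icc (a := -(M + 1)) (b := M + 1)).uniformContinuousOn_of_continuous
    hη.continuousOn
  obtain ⟨d, hd0, hd⟩ := Metric.uniformContinuousOn_iff.1 huc ε hε
  set δ := min (d / 2) 1 with hδ
  have hδ0 : 0 < δ := lt_min (by linarith) one_pos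
  have hδd : δ < d := (min_le_left _ _).trans_lt (by linarith)
  have hδ1 : δ ≤ 1 := min_le_right _ _
  have hint : ∀ w, IntervalIntegrable (fun s => η (w + δ * s)) volume 0 1 := fun w =>
    Continuous.intervalIntegrable (by fun_prop) _ _
  refine ⟨fun w => ∫ s in (0 : ℝ)..1, η (w + δ * s), ?_, ⟨convex_univ, ?_⟩, ?_⟩
  · have e : (fun w => ∫ s in (0 : ℝ)..1, η (w + δ * s)) = fun w =>
        δ⁻¹ * ((∫ s in (0 : ℝ)..(w + δ), η s) - ∫ s in (0 : ℝ)..w, η s) := by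
      funext w
      rw [intervalIntegral.integral_comp_add_mul _ hδ0.ne',
        intervalIntegral.integral_interval_sub_left (hη.intervalIntegrable _ _)
          (hη.intervalIntegrable _ _)]
      simp
    rw [e]
    have h := contDiff_primitive hη
    exact contDiff_const.mul ((h.comp (contDiff_id.add contDiff_const)).sub h)
  · intro x _ y _ a b ha hb hab
    simp only [smul_eq_mul]
    rw [← intervalIntegral.integral_const_mul, ← intervalIntegral.integral_const_mul,
      ← intervalIntegral.integral_add ((hint x).const_mul a) ((hint y).const_mul b)]
    refine intervalIntegral.integral_mono_on zero_le_one (hint _)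
      (((hint x).const_mul a).add ((hint y).const_mul b)) fun s _ => ?_
    have h := hc.2 (mem_univ (x + δ * s)) (mem_univ (y + δ * s)) ha hb hab
    simp only [smul_eq_mul] at h
    have e : a * x + b * y + δ * s = a * (x + δ * s) + b * (y + δ * s) := by
      linear_combination -(δ * s) * hab
    rw [e]
    exact h
  · intro w hw
    have e : (∫ s in (0 : ℝ)..1, η (w + δ * s)) - η w =
        ∫ s in (0 : ℝ)..1, (η (w + δ * s) - η w) := by
      rw [intervalIntegral.integral_sub (hint w) intervalIntegrable_const]
      simp
    have hb := abs_le.1 hw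
    have := intervalIntegral.norm_integral_le_of_norm_le_const (a := 0) (b := 1) (C := ε)
      (f := fun s => η (w + δ * s) - η w) fun s hs => by
        rw [uIoc_of_le zero_le_one] at hs
        have h0 : 0 ≤ δ * s := mul_nonneg hδ0.le hs.1.le
        have h1 : δ * s ≤ δ := by nlinarith [hs.2]
        refine (hd (w + δ * s) ⟨by linarith, by linarith⟩ w ⟨by linarith, by linarith⟩ ?_).le
        rw [Real.dist_eq, add_sub_cancel_left, abs_of_nonneg h0]
        linarith
    rw [e]
    simpa using this

/-! ### The entropy inequality -/

/-- Nothing is known about `u` for `t ≤ 0`; the cutoff makes the products regular on the whole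
plane. -/
theorem contDiff_mul_of_tsupport_subset {F G : ℝ × ℝ → ℝ} {S : Set (ℝ × ℝ)} {n : WithTop ℕ∞}
    (hS : IsOpen S) (hF : ContDiff ℝ n F) (hFs : tsupport F ⊆ S) (hG : ContDiffOn ℝ n G S) :
    ContDiff ℝ n fun p => F p * G p := by
  refine contDiff_iff_contDiffAt.2 fun p => ?_
  by_cases hp : p ∈ tsupport F
  · exact hF.contDiffAt.mul (hG.contDiffAt (hS.mem_nhds (hFs hp)))
  · have : (fun p => F p * G p) =ᶠ[𝓝 p] fun _ => 0 := by
      filter_upwards [(isClosed_tsupport F).isOpen_compl.mem_nhds hp] with q hq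
      rw [image_eq_zero_of_notMem_tsupport hq, zero_mul]
    exact contDiffAt_const.congr_of_eventuallyEq this

theorem integrable_fderiv_apply {F : ℝ × ℝ → ℝ} (hF : ContDiff ℝ 1 F)
    (hFc : HasCompactSupport F) (v : ℝ × ℝ) : Integrable fun p => fderiv ℝ F p v :=
  (contDiff_fderiv_apply (n := 0) (by simpa using hF) v).continuous.integrable_of_hasCompactSupport
    (hFc.fderiv_apply ℝ v)

theorem setIntegral_fderiv_apply_eq_zero {F : ℝ × ℝ → ℝ} {S : Set (ℝ × ℝ)}
    (hF : ContDiff ℝ 1 F) (hFc : HasCompactSupport F) (hFs : tsupport F ⊆ S) (v : ℝ × ℝ) :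
    ∫ p in S, fderiv ℝ F p v = 0 := by
  have hi := integrable_fderiv_apply hF hFc v
  rw [setIntegral_eq_integral_of_forall_compl_eq_zero fun p hp =>
    image_eq_zero_of_notMem_tsupport fun h => hp (hFs (tsupport_fderiv_apply_subset ℝ v h))]
  have := integral_mul_fderiv_eq_neg_fderiv_mul_of_integrable (μ := (volume : Measure (ℝ × ℝ)))
    (f := fun _ => (1 : ℝ)) (g := F) (v := v) (by simp) (by simpa using hi)
    (by simpa using hF.continuous.integrable_of_hasCompactSupport hFc)
    (fun _ _ => differentiableAt_const _) (fun p _ => hF.differentiable one_ne_zero p)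
  simpa using this

section Integrability

variable {β γ : ℝ} {f η : ℝ → ℝ} {u φ : ℝ → ℝ → ℝ}

theorem IsCbTwo.continuousOn (hu : IsCbTwo u) :
    ContinuousOn (Function.uncurry u) (Ioi (0 : ℝ) ×ˢ univ) := hu.contDiffOn.continuousOn

theorem IsCbTwo.integrableOn_comp_mul (hu : IsCbTwo u) (hη : Continuous η)
    {G : ℝ × ℝ → ℝ} (hG : Integrable G) :
    IntegrableOn (fun p => η (Function.uncurry u p) * G p) (Ioi (0 : ℝ) ×ˢ univ) := by
  obtain ⟨M, hM⟩ := hu.exists_bound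
  obtain ⟨C, -, hC⟩ := exists_abs_comp_le hη M
  have hS : MeasurableSet (Ioi (0 : ℝ) ×ˢ (univ : Set ℝ)) :=
    measurableSet_Ioi.prod MeasurableSet.univ
  refine hG.restrict.bdd_mul (c := C)
    ((hη.comp_continuousOn hu.continuousOn).aestronglyMeasurable hS) ?_
  exact (ae_restrict_iff' hS).2 (ae_of_all _ fun p hp => hC _ (hM p.1 hp.1 p.2).1)

theorem uncurry_entropyIntegrand (hφ : ContDiff ℝ 1 (Function.uncurry φ)) :
    Function.uncurry (entropyIntegrand β γ f η u φ) = fun p =>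
      η (Function.uncurry u p) * fderiv ℝ (Function.uncurry φ) p (1, 0) +
      entropyFlux f η (Function.uncurry u p) * fderiv ℝ (Function.uncurry φ) p (0, 1) +
      η (Function.uncurry u p) * rieszFellerAdj β γ (φ p.1) p.2 := by
  funext ⟨t, x⟩
  have d := hφ.differentiable one_ne_zero (t, x)
  rw [← (hasDerivAt_slice_fst d).deriv, ← (hasDerivAt_slice_snd d).deriv]
  rfl

theorem integrableOn_entropyIntegrand (h1 : 1 < β) (h2 : β < 2) (hf : ContDiff ℝ 2 f)
    (hη : Continuous η) (hu : IsCbTwo u) (hφ : ContDiff ℝ 2 (Function.uncurry φ))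
    (hφc : HasCompactSupport (Function.uncurry φ)) :
    IntegrableOn (Function.uncurry (entropyIntegrand β γ f η u φ)) (Ioi (0 : ℝ) ×ˢ univ) := by
  have hφ1 : ContDiff ℝ 1 (Function.uncurry φ) := hφ.of_le one_le_two
  rw [uncurry_entropyIntegrand hφ1]
  exact ((hu.integrableOn_comp_mul hη (integrable_fderiv_apply hφ1 hφc _)).add
    (hu.integrableOn_comp_mul (continuous_entropyFlux hf hη)
      (integrable_fderiv_apply hφ1 hφc _))).add
    (hu.integrableOn_comp_mul hη (integrable_rieszFellerAdj_slice hφ hφc h1 h2 γ))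

end Integrability

/-- By the chain rule the two divergence terms contain `φ η'(u) (∂ₜu + ∂ₓf(u))`, which the equation
replaces by `φ η'(u) D[u]`. -/
theorem entropyIntegrand_eq {β γ : ℝ} {f : ℝ → ℝ} (hf : ContDiff ℝ 2 f) {η : ℝ → ℝ}
    (hη : ContDiff ℝ 1 η) {u : ℝ → ℝ → ℝ} (hu : IsCbTwo u) (hsol : IsSolution β γ f u)
    {φ : ℝ → ℝ → ℝ} (hφ : ContDiff ℝ 1 (Function.uncurry φ)) {t : ℝ} (ht : 0 < t) (x : ℝ) :
    entropyIntegrand β γ f η u φ t x =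
      fderiv ℝ (fun p => Function.uncurry φ p * η (Function.uncurry u p)) (t, x) (1, 0) +
      fderiv ℝ (fun p => Function.uncurry φ p * entropyFlux f η (Function.uncurry u p)) (t, x)
        (0, 1) +
      (η (u t x) * rieszFellerAdj β γ (φ t) x -
        φ t x * deriv η (u t x) * rieszFeller β γ (u t) x) := by
  have du : DifferentiableAt ℝ (Function.uncurry u) (t, x) :=
    (hu.contDiffAt ht x).differentiableAt two_ne_zero
  have dφ := hφ.differentiable one_ne_zero (t, x)
  have ut : HasDerivAt (fun s => u s x) (deriv (fun s => u s x) t) t :=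
    (hasDerivAt_slice_fst du).differentiableAt.hasDerivAt
  have ux : HasDerivAt (u t) (deriv (u t) x) x :=
    (hasDerivAt_slice_snd du).differentiableAt.hasDerivAt
  have φt : HasDerivAt (fun s => φ s x) (deriv (fun s => φ s x) t) t :=
    (hasDerivAt_slice_fst dφ).differentiableAt.hasDerivAt
  have φx : HasDerivAt (φ t) (deriv (φ t) x) x :=
    (hasDerivAt_slice_snd dφ).differentiableAt.hasDerivAt
  have ηu : HasDerivAt η (deriv η (u t x)) (u t x) :=
    (hη.differentiable one_ne_zero _).hasDerivAt
  have w1 : DifferentiableAt ℝ (fun p => Function.uncurry φ p * η (Function.uncurry u p)) (t, x) :=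
    dφ.mul (DifferentiableAt.comp (g := η) (t, x) ηu.differentiableAt du)
  have w2 : DifferentiableAt ℝ
      (fun p => Function.uncurry φ p * entropyFlux f η (Function.uncurry u p)) (t, x) :=
    dφ.mul (DifferentiableAt.comp (g := entropyFlux f η) (t, x)
      (hasDerivAt_entropyFlux hf hη (u t x)).differentiableAt du)
  rw [(hasDerivAt_slice_fst w1).unique (φt.mul (ηu.comp t ut)),
    (hasDerivAt_slice_snd w2).unique (φx.mul ((hasDerivAt_entropyFlux hf hη _).comp x ux))]
  have e3 : deriv (fun y => f (u t y)) x = deriv f (u t x) * deriv (u t) x :=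
    ((hf.differentiable two_ne_zero _).hasDerivAt.comp x ux).deriv
  have e4 := hsol t ht x
  rw [e3] at e4
  simp only [entropyIntegrand, Function.uncurry_apply_pair, ← e4]
  ring

theorem integral_slice_nonneg {β γ : ℝ} (h1 : 1 < β) (h2 : β < 2) (hγ : |γ| ≤ min β (2 - β))
    {η : ℝ → ℝ} (hη : ContDiff ℝ 1 η) (hηc : ConvexOn ℝ univ η) {u : ℝ → ℝ → ℝ} (hu : IsCbTwo u)
    {φ : ℝ → ℝ → ℝ} (hφ : ContDiff ℝ 2 (Function.uncurry φ))
    (hφc : HasCompactSupport (Function.uncurry φ)) (hφ0 : ∀ t x, 0 ≤ φ t x) {t : ℝ}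
    (ht : 0 < t) :
    0 ≤ ∫ x, (η (u t x) * rieszFellerAdj β γ (φ t) x -
      φ t x * deriv η (u t x) * rieszFeller β γ (u t) x) := by
  obtain ⟨M, hM⟩ := hu.exists_bound
  exact integral_mul_rieszFeller_le h1 h2 hγ hη hηc
    (contDiff_slice_snd fun y => hu.contDiffAt ht y) (fun x => (hM t ht x).1)
    (fun x => (hM t ht x).2.1) (fun x => (hM t ht x).2.2)
    (contDiff_slice_snd fun y => hφ.contDiffAt) (hasCompactSupport_slice_snd hφc t) (hφ0 t)

theorem setIntegral_entropyIntegrand_nonneg_of_contDiff {β γ : ℝ} (h1 : 1 < β) (h2 : β < 2)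
    (hγ : |γ| ≤ min β (2 - β)) {f : ℝ → ℝ} (hf : ContDiff ℝ 2 f) {η : ℝ → ℝ}
    (hη : ContDiff ℝ 1 η) (hηc : ConvexOn ℝ univ η) {u : ℝ → ℝ → ℝ} (hu : IsCbTwo u)
    (hsol : IsSolution β γ f u) {φ : ℝ → ℝ → ℝ} (hφ : ContDiff ℝ 2 (Function.uncurry φ))
    (hφc : HasCompactSupport (Function.uncurry φ))
    (hφs : tsupport (Function.uncurry φ) ⊆ Ioi (0 : ℝ) ×ˢ univ) (hφ0 : ∀ t x, 0 ≤ φ t x) :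
    0 ≤ ∫ p in Ioi (0 : ℝ) ×ˢ univ, Function.uncurry (entropyIntegrand β γ f η u φ) p := by
  set S : Set (ℝ × ℝ) := Ioi (0 : ℝ) ×ˢ univ with hS
  have hSo : IsOpen S := isOpen_Ioi.prod isOpen_univ
  have hSm : MeasurableSet S := hSo.measurableSet
  have hφ1 : ContDiff ℝ 1 (Function.uncurry φ) := hφ.of_le one_le_two
  have hu1 : ContDiffOn ℝ 1 (Function.uncurry u) S := hu.contDiffOn.of_le one_le_two
  have hq := contDiff_entropyFlux hf hη
  have w1 := contDiff_mul_of_tsupport_subset hSo hφ1 hφs (hη.comp_contDiffOn hu1)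
  have w2 := contDiff_mul_of_tsupport_subset hSo hφ1 hφs (hq.comp_contDiffOn hu1)
  set W1 : ℝ × ℝ → ℝ := fun p => Function.uncurry φ p * (η ∘ Function.uncurry u) p with hW1
  set W2 : ℝ × ℝ → ℝ :=
    fun p => Function.uncurry φ p * (entropyFlux f η ∘ Function.uncurry u) p with hW2
  have k1 : HasCompactSupport W1 := hφc.mul_right
  have k2 : HasCompactSupport W2 := hφc.mul_right
  have s1 : tsupport W1 ⊆ S := (tsupport_mul_subset_left).trans hφs
  have s2 : tsupport W2 ⊆ S := (tsupport_mul_subset_left).trans hφs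
  set R : ℝ × ℝ → ℝ := fun p => η (u p.1 p.2) * rieszFellerAdj β γ (φ p.1) p.2 -
    φ p.1 p.2 * deriv η (u p.1 p.2) * rieszFeller β γ (u p.1) p.2 with hR
  have key : ∀ p ∈ S, R p = Function.uncurry (entropyIntegrand β γ f η u φ) p -
      (fderiv ℝ W1 p (1, 0) + fderiv ℝ W2 p (0, 1)) := fun p hp =>
    eq_sub_of_add_eq' (entropyIntegrand_eq hf hη hu hsol hφ1 hp.1 p.2).symm
  have iI := integrableOn_entropyIntegrand (γ := γ) h1 h2 hf hη.continuous hu hφ hφc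
  have i1 := (integrable_fderiv_apply w1 k1 (1, 0)).integrableOn (s := S)
  have i2 := (integrable_fderiv_apply w2 k2 (0, 1)).integrableOn (s := S)
  have i12 : IntegrableOn (fun p => fderiv ℝ W1 p (1, 0) + fderiv ℝ W2 p (0, 1)) S := i1.add i2
  -- Integrability of `R` is read off from the identity `key`, which avoids a separate study of
  -- `D[u]` as a function of both variables.
  have iR : IntegrableOn R S :=
    (iI.sub i12).congr_fun (fun p hp => (key p hp).symm) hSm
  have hRI : ∫ p in S, R p =
      ∫ p in S, Function.uncurry (entropyIntegrand β γ f η u φ) p := by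
    rw [setIntegral_congr_fun hSm key, integral_sub iI i12, integral_add i1 i2,
      setIntegral_fderiv_apply_eq_zero w1 k1 s1, setIntegral_fderiv_apply_eq_zero w2 k2 s2]
    ring
  rw [← hRI, Measure.volume_eq_prod, hS, setIntegral_prod _ iR]
  refine setIntegral_nonneg measurableSet_Ioi fun t ht => ?_
  rw [setIntegral_univ]
  exact integral_slice_nonneg h1 h2 hγ hη hηc hu hφ hφc hφ0 ht

theorem setIntegral_entropyIntegrand_nonneg {β γ : ℝ} (h1 : 1 < β) (h2 : β < 2)
    (hγ : |γ| ≤ min β (2 - β)) {f : ℝ → ℝ} (hf : ContDiff ℝ 2 f) {η : ℝ → ℝ}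
    (hη : Continuous η) (hηc : ConvexOn ℝ univ η) {u : ℝ → ℝ → ℝ} (hu : IsCbTwo u)
    (hsol : IsSolution β γ f u) {φ : ℝ → ℝ → ℝ} (hφ : ContDiff ℝ 2 (Function.uncurry φ))
    (hφc : HasCompactSupport (Function.uncurry φ))
    (hφs : tsupport (Function.uncurry φ) ⊆ Ioi (0 : ℝ) ×ˢ univ) (hφ0 : ∀ t x, 0 ≤ φ t x) :
    0 ≤ ∫ p in Ioi (0 : ℝ) ×ˢ univ, Function.uncurry (entropyIntegrand β γ f η u φ) p := by
  have hSm : MeasurableSet (Ioi (0 : ℝ) ×ˢ (univ : Set ℝ)) :=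
    measurableSet_Ioi.prod MeasurableSet.univ
  have hφ1 : ContDiff ℝ 1 (Function.uncurry φ) := hφ.of_le one_le_two
  obtain ⟨M, hM⟩ := hu.exists_bound
  obtain ⟨C, hC0, hC⟩ := exists_abs_entropyFlux_sub_le hf M
  -- Replacing `η` by an entropy `ε`-close to it on `[-M, M]` changes the integrand by at most `ε *
  -- G`.
  set G : ℝ × ℝ → ℝ := fun p => |fderiv ℝ (Function.uncurry φ) p (1, 0)| +
    C * |fderiv ℝ (Function.uncurry φ) p (0, 1)| + |rieszFellerAdj β γ (φ p.1) p.2| with hG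
  have iG : Integrable G := ((integrable_fderiv_apply hφ1 hφc _).abs.add
    ((integrable_fderiv_apply hφ1 hφc _).abs.const_mul C)).add
    (integrable_rieszFellerAdj_slice hφ hφc h1 h2 γ).abs
  set B := ∫ p in Ioi (0 : ℝ) ×ˢ univ, G p with hB
  have iη := integrableOn_entropyIntegrand (γ := γ) h1 h2 hf hη hu hφ hφc
  have approx : ∀ ε, 0 < ε → 0 ≤
      (∫ p in Ioi (0 : ℝ) ×ˢ univ, Function.uncurry (entropyIntegrand β γ f η u φ) p) +
        ε * B := by
    intro ε hε
    obtain ⟨θ, hθ, hθc, hθη⟩ := exists_contDiff_convexOn_approx hη hηc M hε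
    have iθ := integrableOn_entropyIntegrand (γ := γ) h1 h2 hf hθ.continuous hu hφ hφc
    refine (setIntegral_entropyIntegrand_nonneg_of_contDiff h1 h2 hγ hf hθ hθc hu hsol hφ hφc
      hφs hφ0).trans ?_
    rw [hB, ← integral_const_mul, ← integral_add iη (iG.integrableOn.const_mul ε)]
    refine setIntegral_mono_on iθ (iη.add (iG.integrableOn.const_mul ε)) hSm fun p hp => ?_
    have hu' : |Function.uncurry u p| ≤ M := (hM p.1 hp.1 p.2).1
    have a1 := hθη _ hu'
    have a2 := hC θ η hθ.continuous hη ε hθη _ hu'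
    rw [uncurry_entropyIntegrand hφ1, uncurry_entropyIntegrand hφ1]
    have mul_le : ∀ a b d : ℝ, |a| ≤ d → a * b ≤ d * |b| := fun a b d h =>
      (le_abs_self _).trans ((abs_mul a b).trans_le (mul_le_mul_of_nonneg_right h (abs_nonneg b)))
    have b1 := mul_le _ (fderiv ℝ (Function.uncurry φ) p (1, 0)) _ a1
    have b2 := mul_le _ (fderiv ℝ (Function.uncurry φ) p (0, 1)) _ a2
    have b3 := mul_le _ (rieszFellerAdj β γ (φ p.1) p.2) _ a1
    simp only [hG]
    linarith
  refine le_of_forall_pos_le_add fun δ hδ => ?_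
  -- Dividing by `|B| + 1` makes the error at most `δ` without discussing the sign or vanishing of
  -- `B`.
  have hB0 : 0 < |B| + 1 := by positivity
  refine (approx (δ / (|B| + 1)) (by positivity)).trans (add_le_add le_rfl ?_)
  rw [div_mul_eq_mul_div, div_le_iff₀ hB0]
  nlinarith [le_abs_self B]

end RieszFeller

theorem mainTheorem8 (β γ : ℝ) (hβ1 : 1 < β) (hβ2 : β < 2) (hγ : |γ| ≤ min β (2 - β))
    (f : ℝ → ℝ) (hf : ContDiff ℝ ∞ f)
    (η : ℝ → ℝ) (hη : Continuous η) (hηc : ConvexOn ℝ univ η)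
    (u : ℝ → ℝ → ℝ) (hu : RieszFeller.IsCbTwo u) (hsol : RieszFeller.IsSolution β γ f u)
    (φ : ℝ → ℝ → ℝ) (hφ : ContDiff ℝ ∞ (Function.uncurry φ))
    (hφc : HasCompactSupport (Function.uncurry φ))
    (hφs : tsupport (Function.uncurry φ) ⊆ Ioi (0 : ℝ) ×ˢ univ)
    (hφ0 : ∀ t x : ℝ, 0 ≤ φ t x) :
    IntegrableOn (Function.uncurry (RieszFeller.entropyIntegrand β γ f η u φ))
        (Ioi (0 : ℝ) ×ˢ univ) ∧
      0 ≤ ∫ t in Ioi (0 : ℝ), ∫ x : ℝ, RieszFeller.entropyIntegrand β γ f η u φ t x := by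
  have hf2 : ContDiff ℝ 2 f := contDiff_infty.1 hf 2
  have hφ2 : ContDiff ℝ 2 (Function.uncurry φ) := contDiff_infty.1 hφ 2
  have hi := RieszFeller.integrableOn_entropyIntegrand (γ := γ) hβ1 hβ2 hf2 hη hu hφ2 hφc
  refine ⟨hi, ?_⟩
  have h := RieszFeller.setIntegral_entropyIntegrand_nonneg hβ1 hβ2 hγ hf2 hη hηc hu hsol hφ2
    hφc hφs hφ0
  rw [Measure.volume_eq_prod, setIntegral_prod _ hi] at h
  simpa only [setIntegral_univ, Function.uncurry_apply_pair] using h
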